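/- Let $F_\chi$ be the Fock space over $\mathbb{C}$ generated from a vacuum vector $|0\rangle$ by operators $\chi_a$, $a\in\mathbb{Z}+\frac12$, with $[\chi_a,\chi_b]=(-1)^{a-\frac12}\delta_{a,-b}$ and $\chi_a|0\rangle=0$ for $a>0$; it has as a basis the monomials $\chi_{-j_r}^{m_r}\cdots\chi_{-j_1}^{m_1}|0\rangle$ with $j_r>\dots>j_1>0$ in $\mathbb{Z}+\frac12$ and $m_i\in\mathbb{Z}_{>0}$. Let $:\ :$ denote normal ordering (annihilation operators $\chi_a$, $a>0$, to the right), and let $$h_k=\frac12\sum_{a+b=2k}:\chi_a\chi_b:\quad(k\in\mathbb{Z}),\qquad L_0=\frac12\sum_{i\ge0}(-1)^i\left(i+\tfrac12\right):\chi_{-i-\frac12}\chi_{i+\frac12}:$$ be the modes of the untwisted Heisenberg field $\frac1{4z}\left(:\chi(z)\chi(z):-:\chi(-z)\chi(-z):\right)=\sum_k h_kz^{-2k-2}$, where $\chi(z)=\sum_a\chi_az^{-a-\frac12}$, and the degree operator. A vector $v$ has charge $m$ if $h_0v=mv$ and degree $n$ if $2L_0v=nv$; a highest weight vector of degree $n$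 and charge $m$ is a nonzero vector of that degree and charge with $h_kv=0$ for all $k>0$. For a partition $\lambda$ let $\omega(\lambda)$ be the number of its parts equal to $1$. The crank of $\lambda$ is the largest part of $\lambda$ ($0$ for the empty partition) if $\omega(\lambda)=0$, and the number of parts larger than $\omega(\lambda)$ minus $\omega(\lambda)$ otherwise. For $m\in\mathbb{Z}$ and an integer $k\ge0$ let $N'(m,k)$ be the number of partitions of $k$ with crank $m$, except that $N'(-1,1)=N'(1,1)=1$ and $N'(0,1)=-1$; let $N'(m,x)=0$ for every rational $x$ that is not a non-negative integer. Let $n\in\mathbb{Q}$ (for instance $n\in\frac12\mathbb{Z}$) and $m\in\mathbb{Z}$. Then the number of highest weight vectors with degree $n$ and charge $m$, that is, the dimension of the space that they span, is finite and equals $$\sum_{l=0}^{\infty}N'\left(m-l,\frac{2n-m}{4}\right),$$ a sum with only finitely many nonzero terms. Moreover, if $v$ is a highest weight vector of degree $n$ and charge $m$, then $2n\equiv m\pmod 4$, i.e. $2n-m\in4\mathbb{Z}$. -/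

import Mathlib

namespace CKP

/-! ## The Fock space of the modes `χ_a`, `a ∈ ℤ + 1/2`

The mode `χ_{i + 1/2}` is indexed by the integer `i`; thus `i ≥ 0` are the annihilation modes
and `i = -k-1` is the creation mode `χ_{-k-1/2}`. -/

/-- The Fock space `F_χ`, in its standard realization: the polynomial algebra on the creation
modes, the variable `X k` being `χ_{-k-1/2}`, so that the polynomial monomials are the basis
`χ_{-j_r}^{m_r} ⋯ χ_{-j_1}^{m_1} |0⟩`. -/
abbrev Fock : Type := MvPolynomial ℕ ℂ

/-- The vacuum vector `|0⟩`. -/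
noncomputable def vacuum : Fock := 1

/-- The operator `χ_{i + 1/2}` on the Fock space: `χ_{-k-1/2}` is multiplication by the variable
`X k`, and `χ_{k+1/2}` is `(-1)^k ∂/∂(X k)`. -/
noncomputable def chi : ℤ → Module.End ℂ Fock
  | Int.ofNat k => ((-1 : ℂ) ^ k) • (MvPolynomial.pderiv (R := ℂ) k : Fock →ₗ[ℂ] Fock)
  | Int.negSucc k => LinearMap.mulLeft ℂ (MvPolynomial.X k : Fock)

/-- The relation `[χ_a, χ_b] = (-1)^{a - 1/2} δ_{a, -b}`, for `a = i + 1/2` and `b = j + 1/2`. -/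
theorem chi_commutator (i j : ℤ) (v : Fock) :
    chi i (chi j v) - chi j (chi i v) = if i + j = -1 then ((-1 : ℂ) ^ i) • v else 0 := by
  have key : ∀ k l : ℕ, MvPolynomial.pderiv (R := ℂ) k (MvPolynomial.X l * v)
      - MvPolynomial.X l * MvPolynomial.pderiv (R := ℂ) k v = if k = l then v else 0 := by
    intro k l
    rw [Derivation.leibniz, MvPolynomial.pderiv_X]
    by_cases h : k = l
    · subst h; simp [smul_eq_mul]
    · simp [smul_eq_mul, h]
  rcases i with k | k <;> rcases j with l | l
  · have hc : ∀ w : Fock, MvPolynomial.pderiv (R := ℂ) k (MvPolynomial.pderiv (R := ℂ) l w)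
        = MvPolynomial.pderiv (R := ℂ) l (MvPolynomial.pderiv (R := ℂ) k w) := by
      intro w
      have h0 : ⁅MvPolynomial.pderiv (R := ℂ) k, MvPolynomial.pderiv (R := ℂ) l⁆ = 0 := by
        apply MvPolynomial.derivation_ext
        intro x
        rw [Derivation.commutator_apply]
        simp only [MvPolynomial.pderiv_X, Pi.single_apply]
        split_ifs <;> simp
      have := congrArg (fun D => D w) h0
      simpa [Derivation.commutator_apply, sub_eq_zero] using this
    have hne : ¬ (Int.ofNat k + Int.ofNat l = -1) := by simp only [Int.ofNat_eq_natCast]; omega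
    rw [if_neg hne]
    simp only [chi, LinearMap.smul_apply, map_smul, Derivation.coeFn_coe]
    rw [hc v, smul_comm, sub_self]
  · have hiff : (Int.ofNat k + Int.negSucc l = -1) ↔ k = l := by
      simp only [Int.ofNat_eq_natCast, Int.negSucc_eq]; omega
    simp only [chi, LinearMap.smul_apply, Derivation.coeFn_coe, LinearMap.mulLeft_apply,
      mul_smul_comm, ← smul_sub, hiff, key]
    split_ifs <;> simp
  · have hiff : (Int.negSucc k + Int.ofNat l = -1) ↔ l = k := by
      simp only [Int.ofNat_eq_natCast, Int.negSucc_eq]; omega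
    have hk := key l k
    simp only [chi, LinearMap.smul_apply, Derivation.coeFn_coe, LinearMap.mulLeft_apply,
      mul_smul_comm, ← smul_sub, hiff]
    rw [← neg_sub, hk]
    split_ifs with h
    · subst h
      rw [Int.negSucc_eq, zpow_neg, ← inv_zpow, inv_neg, inv_one]
      norm_cast
      rw [pow_succ]
      simp
    · simp
  · have hne : ¬ (Int.negSucc k + Int.negSucc l = -1) := by
      simp only [Int.negSucc_eq]; omega
    rw [if_neg hne]
    simp only [chi, LinearMap.mulLeft_apply]
    ring

/-- The vacuum is killed by every `χ_a` with `a > 0`. -/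
theorem chi_vacuum (k : ℕ) : chi (k : ℤ) vacuum = 0 := by
  change ((-1 : ℂ) ^ k) • MvPolynomial.pderiv (R := ℂ) k (1 : Fock) = 0
  simp

/-- The vacuum generates the Fock space. -/
theorem fock_cyclic (W : Submodule ℂ Fock) (h0 : vacuum ∈ W)
    (h : ∀ (k : ℕ), ∀ v ∈ W, chi (Int.negSucc k) v ∈ W) : W = ⊤ := by
  rw [eq_top_iff]
  intro v _
  induction v using MvPolynomial.induction_on with
  | C a =>
    have := W.smul_mem a h0
    simpa [vacuum, MvPolynomial.smul_eq_C_mul] using this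
  | add p q hp hq => exact W.add_mem (hp trivial) (hq trivial)
  | mul_X p k hp =>
    have := h k p (hp trivial)
    simpa [chi, mul_comm] using this

/-! ## Normal ordered products and locally finite sums of operators -/

/-- The normal ordered product `:χ_{i+1/2} χ_{j+1/2}:`, with annihilation modes on the right. -/
noncomputable def normalOrd (i j : ℤ) : Module.End ℂ Fock :=
  if i < 0 then chi i * chi j else chi j * chi i

/-- The sum of a family of operators of which only finitely many are nonzero on each vector. -/
noncomputable def locSum {ι : Type} (T : ι → Module.End ℂ Fock)
    (hT : ∀ v, (Function.support fun i => T i v).Finite) : Module.End ℂ Fock where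
  toFun v := ∑ᶠ i, T i v
  map_add' v w := by
    simp only [map_add]
    exact finsum_add_distrib (hT v) (hT w)
  map_smul' c v := by
    simp only [map_smul, RingHom.id_apply]
    exact (smul_finsum' c (hT v)).symm

theorem chi_eventually_zero (v : Fock) : ∃ N : ℕ, ∀ i : ℤ, (N : ℤ) ≤ i → chi i v = 0 := by
  refine ⟨v.vars.sup id + 1, fun i hi => ?_⟩
  obtain ⟨k, rfl⟩ := Int.eq_ofNat_of_zero_le (le_trans (Int.natCast_nonneg _) hi)
  have hk : k ∉ v.vars := fun hmem => by
    have : id k ≤ v.vars.sup id := Finset.le_sup hmem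
    simp only [id] at this
    omega
  change ((-1 : ℂ) ^ k) • MvPolynomial.pderiv (R := ℂ) k v = 0
  rw [MvPolynomial.pderiv_eq_zero_of_notMem_vars hk, smul_zero]

theorem normalOrd_finite (s : ℤ) (v : Fock) :
    (Function.support fun i : ℤ => normalOrd i (s - i) v).Finite := by
  obtain ⟨N, hN⟩ := chi_eventually_zero v
  refine ((Set.finite_Ioo (s - N) 0).union (Set.finite_Ico 0 (N : ℤ))).subset fun i hi => ?_
  simp only [Function.mem_support, normalOrd] at hi
  by_cases h : i < 0
  · left
    refine ⟨?_, h⟩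
    by_contra hlt
    apply hi
    rw [if_pos h, Module.End.mul_apply, hN _ (by omega), map_zero]
  · right
    refine ⟨not_lt.mp h, ?_⟩
    by_contra hlt
    apply hi
    rw [if_neg h, Module.End.mul_apply, hN _ (by omega), map_zero]

theorem energy_finite (v : Fock) : (Function.support fun i : ℕ =>
    (((-1 : ℂ) ^ i * ((i : ℂ) + 1 / 2)) • normalOrd (-(i : ℤ) - 1) i) v).Finite := by
  obtain ⟨N, hN⟩ := chi_eventually_zero v
  refine (Set.finite_Iio N).subset fun i hi => ?_
  by_contra hlt
  apply hi
  rw [Set.mem_Iio, not_lt] at hlt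
  have h : (-(i : ℤ) - 1) < 0 := by omega
  simp only [LinearMap.smul_apply, normalOrd]
  rw [if_pos h, Module.End.mul_apply, hN _ (by omega), map_zero, smul_zero]

/-! ## The untwisted Heisenberg modes, the charge and the degree -/

/-- The untwisted Heisenberg mode `h_n = (1/2) ∑_{a + b = 2n} :χ_a χ_b:` (`a, b ∈ ℤ + 1/2`), the
coefficient of `z^{-2n-2}` in `(1/(4z)) (:χ(z)χ(z): - :χ(-z)χ(-z):)`, where
`χ(z) = ∑_a χ_a z^{-a-1/2}`. With `a = i + 1/2` one has `b = (2n - 1 - i) + 1/2`. -/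
noncomputable def heis (n : ℤ) : Module.End ℂ Fock :=
  (1 / 2 : ℂ) • locSum (fun i : ℤ => normalOrd i (2 * n - 1 - i)) (normalOrd_finite (2 * n - 1))

/-- The Virasoro zero mode
`L_0 = (1/2) ((1/2) :χ_{-1/2} χ_{1/2}: - (3/2) :χ_{-3/2} χ_{3/2}: + (5/2) :χ_{-5/2} χ_{5/2}: - ⋯)`. -/
noncomputable def virL0 : Module.End ℂ Fock :=
  (1 / 2 : ℂ) • locSum
    (fun i : ℕ => ((-1 : ℂ) ^ i * ((i : ℂ) + 1 / 2)) • normalOrd (-(i : ℤ) - 1) i) energy_finite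

/-- The space of vectors of charge `m`: the `m`-eigenspace of `h_0`. -/
noncomputable def chargeSpace (m : ℤ) : Submodule ℂ Fock :=
  Module.End.eigenspace (heis 0) (m : ℂ)

/-- The space of vectors of degree `n`: the `n`-eigenspace of `2 L_0`. -/
noncomputable def degreeSpace (n : ℚ) : Submodule ℂ Fock :=
  Module.End.eigenspace ((2 : ℂ) • virL0) (n : ℂ)

/-- The vectors killed by all `h_k`, `k > 0`. Its nonzero homogeneous elements are the highest
weight vectors for the untwisted Heisenberg algebra. -/
noncomputable def hwvSpace : Submodule ℂ Fock :=
  ⨅ k : {k : ℤ // 0 < k}, LinearMap.ker (heis k)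

/-- The highest weight vectors of degree `n` and charge `m`, together with `0`. -/
noncomputable def hwvDegreeCharge (n : ℚ) (m : ℤ) : Submodule ℂ Fock :=
  hwvSpace ⊓ degreeSpace n ⊓ chargeSpace m

/-! ## The crank of a partition -/

/-- The crank of a partition: with `ω` the number of parts equal to `1`, it is the largest part
(`0` for the empty partition) if `ω = 0`, and otherwise the number of parts larger than `ω`
minus `ω`. -/
def crank {k : ℕ} (p : k.Partition) : ℤ :=
  if p.parts.count 1 = 0 then (p.parts.sup : ℤ)
  else ((p.parts.filter fun a => p.parts.count 1 < a).card : ℤ) - (p.parts.count 1 : ℤ)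

/-- `N'(m, k)` for a natural number `k`: the number of partitions of `k` with crank `m`, except
that `N'(-1, 1) = N'(1, 1) = 1` and `N'(0, 1) = -1`. -/
def crankCountNat (m : ℤ) (k : ℕ) : ℤ :=
  if k = 1 ∧ (m = 1 ∨ m = -1) then 1
  else if k = 1 ∧ m = 0 then -1
  else ((Finset.univ.filter fun p : k.Partition => crank p = m).card : ℤ)

/-- `N'(m, x)` for rational `x`: it is `N'(m, k)` if `x` is a natural number `k`, and `0`
otherwise. -/
def crankCount (m : ℤ) (x : ℚ) : ℤ :=
  if x = (⌊x⌋₊ : ℚ) then crankCountNat m ⌊x⌋₊ else 0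

end CKP

/-! The variable `X k` has charge `(-1)^k` and degree `k + 1/2`, so on every monomial `2n - m` is
four times the grade `N` in which `X k` has weight `⌊(k+1)/2⌋`. The vectors of charge `m` and grade
`N` are therefore spanned by finitely many monomials. Counting even and odd variables separately
gives the dimension series `F_m = ∑_j q^j / ((q)_j (q)_{m+j})` (`coeff_fockSeries`).

The modes satisfy `[h_k, h_{-r}] = -k δ_{k,r}` for `k, r ≥ 0` (`heis_commutator_neg`), and `h_k`
preserves the charge and lowers the grade by `k`. As grades are bounded below, `h_{r+1}` maps the
common kernel of `h_1, …, h_r` onto itself (`exists_preimage_of_commutator`), so each further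
condition `h_k v = 0` multiplies the series by `1 - q^k` (`finrank_partialHwv_succ`). Highest weight
vectors of charge `m` thus have the series `H_m = (q)_∞ F_m`.

From `1/(q)_z - 1/(q)_{z-1} = q^z/(q)_z` one gets `H_m - H_{m-1} = (q)_∞ ∑_j q^{j+(m+j)} / ((q)_j
(q)_{m+j})`. Sorting partitions by their number `j` of ones, the series of `N'(m, ·)` is `(1-q) ∑_j
q^{j+(m+j)(j+1)} / ((q)_j (q)_{m+j})` (`crankCountNat_eq_coeff`). A limiting case of Heine's
transformation (`X_pow_dvd_heine`), obtained from `q`-Vandermonde and Euler's sum, shows that the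
two agree. Hence `N'(m, N)` is the difference of the dimensions for the charges `m` and `m - 1`, and
summing over `m - l` telescopes. Infinite sums and products are handled as congruences modulo `X ^
K`. -/

namespace CKP

/-! ### Operator identities: Heisenberg relations, diagonality of charge and degree. -/

section Operators

open MvPolynomial

/-! ### Commutators with the modes -/

/-- A form of Schur's lemma: `Z 1` is killed by all derivatives, hence constant, and the creation
modes carry `Z 1 = 0` to every polynomial. It reduces operator identities to commutators with the
`χ` and a vacuum expectation. -/
theorem commute_chi_eq_zero (Z : Module.End ℂ Fock)
    (hZ : ∀ i v, Z (chi i v) = chi i (Z v)) (h1 : constantCoeff (Z 1) = 0) : Z = 0 := by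
  have hd : ∀ k : ℕ, pderiv k (Z 1) = 0 := by
    intro k
    have h := hZ (Int.ofNat k) 1
    simp only [chi, LinearMap.smul_apply, Derivation.coeFn_coe, pderiv_one, smul_zero,
      map_zero] at h
    exact (smul_eq_zero.1 h.symm).resolve_left (pow_ne_zero _ (by norm_num))
  have hZ1 : Z 1 = 0 := by
    ext d
    by_cases hd0 : d = 0
    · subst hd0
      simpa [constantCoeff_eq] using h1
    · obtain ⟨k, hk⟩ := Finsupp.ne_iff.1 hd0
      have h := congrArg (coeff (d - Finsupp.single k 1)) (hd k)
      have hle : Finsupp.single k 1 ≤ d := by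
        rw [Finsupp.single_le_iff]
        exact Nat.one_le_iff_ne_zero.2 hk
      rw [coeff_pderiv, tsub_add_cancel_of_le hle, coeff_zero] at h
      rw [coeff_zero]
      refine (mul_eq_zero.1 h).resolve_right ?_
      exact Nat.cast_add_one_ne_zero _
  refine LinearMap.ext fun v => ?_
  induction v using MvPolynomial.induction_on with
  | C a => rw [← mul_one (C a), ← smul_eq_C_mul, map_smul, hZ1]; simp
  | add p q hp hq => rw [map_add, hp, hq]; simp
  | mul_X p k hp =>
    have h := hZ (Int.negSucc k) p
    simp only [chi, LinearMap.mulLeft_apply] at h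
    rw [mul_comm, h, hp]; simp

/-- Normal ordering changes a product only by a scalar, which drops out of the commutator. -/
theorem normalOrd_commutator (i s j : ℤ) (v : Fock) :
    normalOrd i (s - i) (chi j v) - chi j (normalOrd i (s - i) v) =
      (if i = -1 - j then ((-1 : ℂ) ^ i) • chi (s - i) v else 0) +
      (if i = s + 1 + j then ((-1 : ℂ) ^ (s - i)) • chi i v else 0) := by
  have h1 := chi_commutator i j
  have h2 := chi_commutator (s - i) j
  have e1 : i + j = -1 ↔ i = -1 - j := by omega
  have e2 : s - i + j = -1 ↔ i = s + 1 + j := by omega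
  simp only [e1, e2, sub_eq_iff_eq_add] at h1 h2
  unfold normalOrd
  split_ifs with h <;> simp only [Module.End.mul_apply, h1, h2, map_add] <;> split_ifs <;>
    simp only [map_smul, map_zero] <;> abel

theorem heis_apply (n : ℤ) (v : Fock) :
    heis n v = (1 / 2 : ℂ) • ∑ᶠ i : ℤ, normalOrd i (2 * n - 1 - i) v := rfl

theorem virL0_apply (v : Fock) : virL0 v = (1 / 2 : ℂ) • ∑ᶠ i : ℕ,
    (((-1 : ℂ) ^ i * ((i : ℂ) + 1 / 2)) • normalOrd (-(i : ℤ) - 1) i) v := rfl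

theorem finsum_ite_eq_single {ι : Type*} (a : ι) (f : ι → Fock) [DecidableEq ι] :
    ∑ᶠ i, (if i = a then f i else 0) = f a := by
  rw [finsum_eq_single _ a fun i hi => if_neg hi, if_pos rfl]

theorem support_ite_eq_finite {ι : Type*} (a : ι) (f : ι → Fock) [DecidableEq ι] :
    (Function.support fun i => if i = a then f i else 0).Finite :=
  (Set.finite_singleton a).subset fun i hi => by
    by_contra h
    exact hi (if_neg h)

theorem neg_one_zpow_congr {a b : ℤ} (h : Even (a - b)) : (-1 : ℂ) ^ a = (-1) ^ b := by
  rw [← sub_add_cancel a b, zpow_add₀ (by norm_num), h.neg_one_zpow, one_mul]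

/-- Only the indices `-1 - j` and `2n + j` contribute, and they contribute equally, which absorbs
the factor `1/2`. -/
theorem heis_commutator_chi (n j : ℤ) (v : Fock) :
    heis n (chi j v) - chi j (heis n v) = ((-1 : ℂ) ^ (j + 1)) • chi (2 * n + j) v := by
  have hmap : chi j (∑ᶠ i : ℤ, normalOrd i (2 * n - 1 - i) v) =
      ∑ᶠ i : ℤ, chi j (normalOrd i (2 * n - 1 - i) v) :=
    (chi j).toAddMonoidHom.map_finsum (normalOrd_finite _ v)
  have hfin : (Function.support fun i : ℤ => chi j (normalOrd i (2 * n - 1 - i) v)).Finite :=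
    (normalOrd_finite (2 * n - 1) v).subset fun i hi h => hi (by simp only [h, map_zero])
  rw [heis_apply, heis_apply, map_smul, hmap, ← smul_sub,
    ← finsum_sub_distrib (normalOrd_finite _ _) hfin]
  simp only [normalOrd_commutator]
  rw [finsum_add_distrib (support_ite_eq_finite _ _) (support_ite_eq_finite _ _),
    finsum_ite_eq_single, finsum_ite_eq_single, neg_one_zpow_congr (a := -1 - j) (b := j + 1),
    neg_one_zpow_congr (a := 2 * n - 1 - (2 * n - 1 + 1 + j)) (b := j + 1),
    show 2 * n - 1 - (-1 - j) = 2 * n + j by ring, show 2 * n - 1 + 1 + j = 2 * n + j by ring,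
    ← two_smul ℂ, smul_smul]
  · norm_num
  · exact ⟨-1 - j, by ring⟩
  · exact ⟨-1 - j, by ring⟩

theorem normalOrd_energy_commutator (i : ℕ) (j : ℤ) (v : Fock) :
    normalOrd (-(i : ℤ) - 1) i (chi j v) - chi j (normalOrd (-(i : ℤ) - 1) i v) =
      if (i : ℤ) = j then -((-1 : ℂ) ^ i) • chi j v else
      if (i : ℤ) = -1 - j then ((-1 : ℂ) ^ i) • chi j v else 0 := by
  have h := normalOrd_commutator (-(i : ℤ) - 1) (-1) j v
  rw [show (-1 : ℤ) - (-(i : ℤ) - 1) = i by ring] at h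
  rw [h, neg_one_zpow_congr (a := -(i : ℤ) - 1) (b := i + 1) ⟨-i - 1, by ring⟩,
    zpow_add₀ (by norm_num), zpow_natCast]
  by_cases h1 : (i : ℤ) = j
  · rw [if_pos (by omega), if_neg (by omega), if_pos h1, h1]
    simp
  · rw [if_neg (by omega), if_neg h1]
    by_cases h2 : (i : ℤ) = -1 - j
    · rw [if_pos (by omega), if_pos h2, show -(i : ℤ) - 1 = j by omega]
      simp
    · rw [if_neg (by omega), if_neg h2, add_zero]

theorem virL0_commutator_chi (j : ℤ) (v : Fock) :
    virL0 (chi j v) - chi j (virL0 v) = (-(1 / 2 : ℂ) * (j + 1 / 2)) • chi j v := by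
  have hmap : chi j (∑ᶠ i : ℕ,
      (((-1 : ℂ) ^ i * ((i : ℂ) + 1 / 2)) • normalOrd (-(i : ℤ) - 1) i) v) =
      ∑ᶠ i : ℕ, chi j ((((-1 : ℂ) ^ i * ((i : ℂ) + 1 / 2)) • normalOrd (-(i : ℤ) - 1) i) v) :=
    (chi j).toAddMonoidHom.map_finsum (energy_finite v)
  have hfin : (Function.support fun i : ℕ => chi j
      ((((-1 : ℂ) ^ i * ((i : ℂ) + 1 / 2)) • normalOrd (-(i : ℤ) - 1) i) v)).Finite :=
    (energy_finite v).subset fun i hi h => hi (by simp only [h, map_zero])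
  rw [virL0_apply, virL0_apply, map_smul, hmap, ← smul_sub,
    ← finsum_sub_distrib (energy_finite _) hfin]
  simp only [LinearMap.smul_apply, map_smul, ← smul_sub, normalOrd_energy_commutator]
  rcases lt_or_ge j 0 with hj | hj
  · obtain ⟨k, hk⟩ := Int.eq_ofNat_of_zero_le (show 0 ≤ -1 - j by omega)
    rw [finsum_eq_single _ k]
    · rw [if_neg (by omega), if_pos hk.symm, smul_smul, smul_smul, show j = -1 - (k : ℤ) by omega]
      congr 1
      have : ((-1 : ℂ) ^ k) * (-1) ^ k = 1 := by rw [← mul_pow]; simp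
      push_cast
      linear_combination (1 / 2 * ((k : ℂ) + 1 / 2)) * this
    · intro i hi
      rw [if_neg (by omega), if_neg (by omega), smul_zero]
  · obtain ⟨k, rfl⟩ := Int.eq_ofNat_of_zero_le hj
    rw [finsum_eq_single _ k]
    · rw [if_pos rfl, smul_smul, smul_smul]
      congr 1
      have : ((-1 : ℂ) ^ k) * (-1) ^ k = 1 := by rw [← mul_pow]; simp
      push_cast
      linear_combination -(1 / 2 * ((k : ℂ) + 1 / 2)) * this
    · intro i hi
      rw [if_neg (by omega), if_neg (by omega), smul_zero]

/-! ### The vacuum -/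

theorem chi_one_of_nonneg {j : ℤ} (hj : 0 ≤ j) : chi j (1 : Fock) = 0 := by
  obtain ⟨k, rfl⟩ := Int.eq_ofNat_of_zero_le hj
  exact chi_vacuum k

theorem heis_one_of_nonneg {n : ℤ} (hn : 0 ≤ n) : heis n (1 : Fock) = 0 := by
  rw [heis_apply]
  have h : ∀ i : ℤ, normalOrd i (2 * n - 1 - i) (1 : Fock) = 0 := by
    intro i
    unfold normalOrd
    split_ifs with hi <;> rw [Module.End.mul_apply]
    · rw [chi_one_of_nonneg (by omega), map_zero]
    · rw [chi_one_of_nonneg (by omega), map_zero]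
  simp [h]

theorem virL0_one : virL0 (1 : Fock) = 0 := by
  rw [virL0_apply]
  have h : ∀ i : ℕ, normalOrd (-(i : ℤ) - 1) i (1 : Fock) = 0 := by
    intro i
    unfold normalOrd
    rw [if_pos (by omega), Module.End.mul_apply, chi_one_of_nonneg (by omega), map_zero]
  simp [h]

theorem constantCoeff_chi_of_neg {j : ℤ} (hj : j < 0) (v : Fock) :
    constantCoeff (chi j v) = 0 := by
  obtain ⟨k, rfl⟩ := Int.eq_negSucc_of_lt_zero hj
  simp [chi]

/-- `h_{-r} |0⟩` for `r > 0` is a finite quadratic sum. -/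
theorem heis_neg_one (r : ℕ) : heis (-(r : ℤ)) (1 : Fock) =
    (1 / 2 : ℂ) • ∑ i ∈ Finset.range (2 * r),
      chi (-(i : ℤ) - 1) (chi (-(2 * r : ℤ) + i) (1 : Fock)) := by
  rw [heis_apply]
  congr 1
  have hinj : Function.Injective fun i : ℕ => -(i : ℤ) - 1 := fun a b h => by
    simp only at h; omega
  rw [finsum_eq_sum_of_support_subset (s := (Finset.range (2 * r)).map ⟨_, hinj⟩),
    Finset.sum_map]
  · refine Finset.sum_congr rfl fun i _ => ?_
    simp only [Function.Embedding.coeFn_mk, normalOrd]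
    rw [if_pos (by omega), Module.End.mul_apply,
      show 2 * -(r : ℤ) - 1 - (-(i : ℤ) - 1) = -(2 * r : ℤ) + i by ring]
  · intro i hi
    simp only [Finset.coe_map, Function.Embedding.coeFn_mk, Set.mem_image, Finset.coe_range,
      Set.mem_Iio]
    by_contra hne
    apply hi
    have hi' : 0 ≤ i ∨ i < -(2 * r : ℤ) := by
      by_contra! hlt
      exact hne ⟨(-1 - i).toNat, by omega, by omega⟩
    simp only [normalOrd]
    rcases hi' with h | h
    · rw [if_neg (by omega), Module.End.mul_apply, chi_one_of_nonneg h, map_zero]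
    · rw [if_pos (by omega), Module.End.mul_apply, chi_one_of_nonneg (by omega), map_zero]

theorem constantCoeff_heis_one (n : ℤ) : constantCoeff (heis n (1 : Fock)) = 0 := by
  rcases le_or_gt 0 n with hn | hn
  · rw [heis_one_of_nonneg hn, map_zero]
  · obtain ⟨r, rfl⟩ : ∃ r : ℕ, n = -(r : ℤ) := ⟨n.natAbs, by omega⟩
    rw [heis_neg_one, smul_eq_C_mul, map_mul, map_sum, Finset.sum_eq_zero, mul_zero]
    intro i _
    exact constantCoeff_chi_of_neg (by omega) _

/-- Commuting `h_j` past the first mode and contracting the result with the second leaves `-1` for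
each of the `2r` summands when `j = r`; the factor `1/2` makes this `-r`. -/
theorem constantCoeff_heis_heis_one (j : ℤ) (hj : 0 ≤ j) (r : ℕ) :
    constantCoeff (heis j (heis (-(r : ℤ)) (1 : Fock))) = if j = r then -(j : ℂ) else 0 := by
  have hterm : ∀ i ∈ Finset.range (2 * r), constantCoeff (heis j
      (chi (-(i : ℤ) - 1) (chi (-(2 * r : ℤ) + i) (1 : Fock)))) = if j = r then (-1 : ℂ) else 0 := by
    intro i hi
    rw [Finset.mem_range] at hi
    have h1 := heis_commutator_chi j (-(i : ℤ) - 1) (chi (-(2 * r : ℤ) + i) (1 : Fock))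
    rw [sub_eq_iff_eq_add] at h1
    rw [h1, map_add, constantCoeff_chi_of_neg (by omega), add_zero, smul_eq_C_mul, map_mul,
      constantCoeff_C]
    have h2 := chi_commutator (2 * j + (-(i : ℤ) - 1)) (-(2 * r : ℤ) + i) (1 : Fock)
    rw [sub_eq_iff_eq_add] at h2
    rw [h2, map_add, constantCoeff_chi_of_neg (by omega), add_zero]
    by_cases hjr : j = r
    · rw [if_pos (by omega), if_pos hjr, smul_eq_C_mul, map_mul, constantCoeff_C, map_one, mul_one,
        ← zpow_add₀ (by norm_num)]
      refine Odd.neg_one_zpow ⟨j - i - 1, by ring⟩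
    · rw [if_neg (by omega), if_neg hjr]; simp
  rw [heis_neg_one, map_smul, map_sum, smul_eq_C_mul, map_mul, map_sum, Finset.sum_congr rfl hterm]
  split_ifs with h
  · subst h; simp
  · simp

/-! ### The Heisenberg relations -/

/-- The adjoint actions of `h_m` and `h_n` shift the index of `χ` by even amounts, so the signs
`(-1)^(i+1)` persist and the two actions commute. -/
theorem heis_commutator_commutes (m n i : ℤ) (v : Fock) :
    (heis m * heis n - heis n * heis m) (chi i v) =
      chi i ((heis m * heis n - heis n * heis m) v) := by
  have e : ∀ a b w, heis a (chi b w) = ((-1 : ℂ) ^ (b + 1)) • chi (2 * a + b) w + chi b (heis a w) :=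
    fun a b w => sub_eq_iff_eq_add.1 (heis_commutator_chi a b w)
  simp only [LinearMap.sub_apply, Module.End.mul_apply, e, map_add, map_smul, map_sub]
  rw [neg_one_zpow_congr (a := 2 * m + i + 1) (b := i + 1) ⟨m, by ring⟩,
    neg_one_zpow_congr (a := 2 * n + i + 1) (b := i + 1) ⟨n, by ring⟩,
    show 2 * n + (2 * m + i) = 2 * m + (2 * n + i) by ring]
  module

theorem heis_commute_of_nonneg {m n : ℤ} (hm : 0 ≤ m) (hn : 0 ≤ n) :
    heis m * heis n = heis n * heis m := by
  rw [← sub_eq_zero]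
  refine commute_chi_eq_zero _ (heis_commutator_commutes m n) ?_
  simp only [LinearMap.sub_apply, Module.End.mul_apply]
  rw [heis_one_of_nonneg hm, heis_one_of_nonneg hn]; simp

theorem heis_commutator_neg {m : ℤ} (hm : 0 ≤ m) (r : ℕ) :
    heis m * heis (-(r : ℤ)) - heis (-(r : ℤ)) * heis m =
      (if m = r then -(m : ℂ) else 0) • (1 : Module.End ℂ Fock) := by
  rw [← sub_eq_zero]
  refine commute_chi_eq_zero _ (fun i v => ?_) ?_
  · rw [LinearMap.sub_apply, heis_commutator_commutes, LinearMap.sub_apply, map_sub]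
    split_ifs <;> simp
  · simp only [LinearMap.sub_apply, Module.End.mul_apply, map_sub]
    rw [heis_one_of_nonneg hm, constantCoeff_heis_heis_one m hm]
    split_ifs <;> simp

/-- Such an `A` is diagonal with eigenvalue `0` on the vacuum, so it produces no constant term. This
supplies the vacuum condition in `virL0_heis`. -/
theorem constantCoeff_of_commutator (A : Module.End ℂ Fock) (h1 : A 1 = 0)
    (a : ℤ → ℂ) (hA : ∀ j v, A (chi j v) - chi j (A v) = a j • chi j v) (p : Fock) :
    constantCoeff (A p) = 0 := by
  induction p using MvPolynomial.induction_on with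
  | C c => rw [← mul_one (C c), ← smul_eq_C_mul, map_smul, h1]; simp
  | add p q hp hq => rw [map_add, map_add, hp, hq, add_zero]
  | mul_X p k _ =>
    have h := hA (Int.negSucc k) p
    rw [sub_eq_iff_eq_add] at h
    have e : p * X k = chi (Int.negSucc k) p := by simp [chi, mul_comm]
    rw [e, h, map_add, smul_eq_C_mul, map_mul, constantCoeff_chi_of_neg (Int.negSucc_lt_zero k),
      constantCoeff_chi_of_neg (Int.negSucc_lt_zero k)]
    simp

theorem virL0_heis (n : ℤ) (v : Fock) :
    virL0 (heis n v) = heis n (virL0 v) - (n : ℂ) • heis n v := by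
  have key : virL0 * heis n - heis n * virL0 + (n : ℂ) • heis n = 0 := by
    refine commute_chi_eq_zero _ (fun i v => ?_) ?_
    · have e : ∀ a b w, heis a (chi b w) =
          ((-1 : ℂ) ^ (b + 1)) • chi (2 * a + b) w + chi b (heis a w) :=
        fun a b w => sub_eq_iff_eq_add.1 (heis_commutator_chi a b w)
      have f : ∀ j w, virL0 (chi j w) = (-(1 / 2 : ℂ) * (j + 1 / 2)) • chi j w + chi j (virL0 w) :=
        fun j w => sub_eq_iff_eq_add.1 (virL0_commutator_chi j w)
      simp only [LinearMap.sub_apply, LinearMap.add_apply, LinearMap.smul_apply,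
        Module.End.mul_apply, e, f, map_add, map_smul, map_sub]
      push_cast
      module
    · simp only [LinearMap.sub_apply, LinearMap.add_apply, LinearMap.smul_apply,
        Module.End.mul_apply, virL0_one, map_zero, sub_zero, map_add]
      rw [constantCoeff_of_commutator virL0 virL0_one _ virL0_commutator_chi _,
        smul_eq_C_mul, map_mul, constantCoeff_heis_one]
      simp
  have := LinearMap.congr_fun key v
  simp only [LinearMap.sub_apply, LinearMap.add_apply, LinearMap.smul_apply,
    Module.End.mul_apply, LinearMap.zero_apply] at this
  rw [← sub_eq_zero, ← this]
  abel

theorem heis_zero_heis (n : ℤ) (v : Fock) : heis 0 (heis n v) = heis n (heis 0 v) := by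
  rcases le_or_gt 0 n with hn | hn
  · exact LinearMap.congr_fun (heis_commute_of_nonneg le_rfl hn) v
  · obtain ⟨r, rfl⟩ : ∃ r : ℕ, n = -(r : ℤ) := ⟨n.natAbs, by omega⟩
    have h := LinearMap.congr_fun (heis_commutator_neg le_rfl r) v
    simp only [LinearMap.sub_apply, Module.End.mul_apply, Int.cast_zero, neg_zero, ite_self,
      zero_smul, LinearMap.zero_apply] at h
    exact sub_eq_zero.1 h

/-! ### Diagonal operators -/

/-- Multiplication by `X k` is an eigenvector of the adjoint action of `A`, so eigenvalues add over
the factors of a monomial. -/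
theorem apply_monomial_of_commutator (A : Module.End ℂ Fock) (h1 : A 1 = 0)
    (a : ℕ → ℂ) (hA : ∀ k v, A (X k * v) - X k * A v = a k • (X k * v)) (d : ℕ →₀ ℕ) :
    A (monomial d 1) = (d.sum fun k e => e * a k) • monomial d (1 : ℂ) := by
  have mul : ∀ (k e : ℕ) (v : Fock) (μ : ℂ), A v = μ • v →
      A (X k ^ e * v) = (e * a k + μ) • (X k ^ e * v) := by
    intro k e v μ hv
    induction e with
    | zero => simp [hv]
    | succ e ih =>
      have h := hA k (X k ^ e * v)
      rw [sub_eq_iff_eq_add, ih] at h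
      rw [pow_succ', mul_assoc, h, mul_smul_comm, ← add_smul]
      congr 1
      push_cast
      ring
  induction d using Finsupp.induction with
  | zero => simpa using h1
  | single_add k e f _ _ ih =>
    have e1 : monomial (Finsupp.single k e + f) (1 : ℂ) = X k ^ e * monomial f 1 := by
      rw [X_pow_eq_monomial, monomial_mul, one_mul]
    rw [e1, mul _ _ _ _ ih, Finsupp.sum_add_index' (by simp) (by intros; push_cast; ring),
      Finsupp.sum_single_index (by simp)]

theorem coeff_apply_of_commutator (A : Module.End ℂ Fock) (h1 : A 1 = 0)
    (a : ℕ → ℂ) (hA : ∀ k v, A (X k * v) - X k * A v = a k • (X k * v)) (d : ℕ →₀ ℕ) (v : Fock) :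
    coeff d (A v) = (d.sum fun k e => e * a k) * coeff d v := by
  induction v using MvPolynomial.induction_on' with
  | monomial f c =>
    have e : monomial f c = c • monomial f (1 : ℂ) := by simp [smul_monomial]
    rw [e, map_smul, apply_monomial_of_commutator A h1 a hA]
    simp only [coeff_smul, coeff_monomial, smul_eq_mul]
    split_ifs with h
    · subst h; ring
    · simp
  | add p q hp hq => rw [map_add, coeff_add, coeff_add, hp, hq, mul_add]

/-- The charge of a monomial. -/
def chargeOf (d : ℕ →₀ ℕ) : ℤ := d.sum fun k e => e * (-1) ^ k

/-- The degree `n` and charge `m` of a monomial satisfy `2 n - m = 4 * gradeOf d`. -/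
def gradeOf (d : ℕ →₀ ℕ) : ℕ := d.sum fun k e => e * ((k + 1) / 2)

theorem coeff_heis_zero (d : ℕ →₀ ℕ) (v : Fock) :
    coeff d (heis 0 v) = (chargeOf d : ℂ) * coeff d v := by
  rw [coeff_apply_of_commutator (heis 0) (heis_one_of_nonneg le_rfl) (fun k => (-1) ^ k)]
  · simp [chargeOf, Finsupp.sum]
  · intro k v
    have h := heis_commutator_chi 0 (Int.negSucc k) v
    rw [mul_zero, zero_add] at h
    simp only [chi, LinearMap.mulLeft_apply] at h
    rw [h, neg_one_zpow_congr (b := (k : ℤ)) ⟨-k, by rw [Int.negSucc_eq]; ring⟩, zpow_natCast]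

theorem coeff_virL0 (d : ℕ →₀ ℕ) (v : Fock) :
    coeff d (((2 : ℂ) • virL0) v) =
      ((4 * gradeOf d + chargeOf d : ℂ) / 2) * coeff d v := by
  -- Twice the degree of `X k` minus its charge is `4 ⌊(k+1)/2⌋`: the source of the weight in
  -- `gradeOf` and of the congruence modulo 4.
  have h0 : ∀ k : ℕ, (4 * ((k + 1) / 2 : ℕ) + (-1 : ℂ) ^ k) / 2 = k + 1 / 2 := by
    intro k
    rcases Nat.even_or_odd' k with ⟨j, rfl | rfl⟩
    · rw [show (2 * j + 1) / 2 = j by omega]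
      simp; ring
    · rw [show (2 * j + 1 + 1) / 2 = j + 1 by omega, pow_succ]
      simp; ring
  rw [coeff_apply_of_commutator _ (by simp [virL0_one]) (fun k => k + 1 / 2)]
  · congr 1
    simp only [gradeOf, chargeOf, Finsupp.sum]
    push_cast
    rw [Finset.mul_sum, ← Finset.sum_add_distrib, Finset.sum_div]
    refine Finset.sum_congr rfl fun k _ => ?_
    rw [← h0 k]
    ring
  · intro k v
    have h := virL0_commutator_chi (Int.negSucc k) v
    simp only [chi, LinearMap.mulLeft_apply] at h
    rw [LinearMap.smul_apply, LinearMap.smul_apply, mul_smul_comm, ← smul_sub, h, smul_smul]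
    congr 1
    push_cast [Int.negSucc_eq]
    ring

end Operators

/-! ### Graded pieces and the dimensions of spaces of highest weight vectors. -/

section Dimensions

open MvPolynomial

/-- The monomials of charge `m` and grade `N`. -/
def monoSet (m N : ℤ) : Set (ℕ →₀ ℕ) := {d | chargeOf d = m ∧ (gradeOf d : ℤ) = N}

theorem mul_le_gradeOf (d : ℕ →₀ ℕ) (k : ℕ) : d k * ((k + 1) / 2) ≤ gradeOf d := by
  by_cases hk : k ∈ d.support
  · exact Finset.single_le_sum (f := fun k => d k * ((k + 1) / 2)) (fun _ _ => Nat.zero_le _) hk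
  · simp [Finsupp.notMem_support_iff.1 hk]

/-- The grade does not see `X 0`. In charge plus grade every variable has nonnegative weight and `X
0` has weight `1`. -/
theorem apply_zero_le (d : ℕ →₀ ℕ) : (d 0 : ℤ) ≤ chargeOf d + gradeOf d := by
  have h : chargeOf d + gradeOf d = ∑ k ∈ d.support, ((d k : ℤ) * ((-1) ^ k + ((k + 1) / 2 : ℕ))) := by
    simp only [chargeOf, gradeOf, Finsupp.sum, mul_add, Finset.sum_add_distrib]
    push_cast
    rfl
  have hnn : ∀ k ∈ d.support, (0 : ℤ) ≤ (d k : ℤ) * ((-1) ^ k + ((k + 1) / 2 : ℕ)) := by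
    intro k _
    refine mul_nonneg (Int.natCast_nonneg _) ?_
    rcases Nat.even_or_odd' k with ⟨j, rfl | rfl⟩
    · simp; positivity
    · rw [show (2 * j + 1 + 1) / 2 = j + 1 by omega, pow_succ]
      simp
  rw [h]
  by_cases hk : 0 ∈ d.support
  · refine le_trans ?_ (Finset.single_le_sum hnn hk)
    simp
  · rw [Finsupp.notMem_support_iff.1 hk]
    exact Finset.sum_nonneg hnn

theorem monoSet_finite (m N : ℤ) : (monoSet m N).Finite := by
  -- Variables `X k` with `k > 2N` have grade above `N`; for `0 < k ≤ 2N` the exponent is at most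
  -- `N`, and that of `X 0` at most `m + N`.
  refine (Set.finite_Icc (0 : ℕ →₀ ℕ) (Finsupp.onFinset (Finset.range (2 * N.toNat + 1))
    (fun k => if k ≤ 2 * N.toNat then (m + N).toNat + N.toNat else 0) ?_)).subset ?_
  · intro k hk
    by_contra h
    exact hk (if_neg fun h' => h (Finset.mem_range.2 (by omega)))
  · rintro d ⟨hc, hg⟩
    refine ⟨zero_le, fun k => ?_⟩
    have h0 := apply_zero_le d
    have hk := mul_le_gradeOf d k
    rw [Finsupp.onFinset_apply]
    rcases Nat.eq_zero_or_pos k with rfl | hpos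
    · rw [if_pos (Nat.zero_le _)]; omega
    · have h1 : 1 ≤ (k + 1) / 2 := by omega
      split_ifs with hkN
      · have := Nat.mul_le_mul_left (d k) h1
        omega
      · by_contra hne
        have : 1 * ((k + 1) / 2) ≤ d k * ((k + 1) / 2) := Nat.mul_le_mul_right _ (by omega)
        omega

theorem monoSet_eq_empty {m N : ℤ} (h : N < 0 ∨ m + N < 0) : monoSet m N = ∅ := by
  rw [Set.eq_empty_iff_forall_notMem]
  rintro d ⟨hc, hg⟩
  have := apply_zero_le d
  omega

/-! ### The joint eigenspaces -/

theorem mem_degree_charge_iff (n : ℚ) (m : ℤ) (v : Fock) :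
    v ∈ degreeSpace n ⊓ chargeSpace m ↔
      ∀ d ∈ v.support, 2 * n - m = 4 * (gradeOf d : ℚ) ∧ chargeOf d = m := by
  rw [Submodule.mem_inf, degreeSpace, chargeSpace, Module.End.mem_eigenspace_iff,
    Module.End.mem_eigenspace_iff]
  constructor
  · rintro ⟨h1, h2⟩ d hd
    have hd' : coeff d v ≠ 0 := mem_support_iff.1 hd
    have e1 := congrArg (coeff d) h1
    have e2 := congrArg (coeff d) h2
    rw [coeff_virL0, coeff_smul, smul_eq_mul] at e1
    rw [coeff_heis_zero, coeff_smul, smul_eq_mul] at e2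
    have f1 := mul_right_cancel₀ hd' e1
    have f2 := mul_right_cancel₀ hd' e2
    have f3 : chargeOf d = m := by exact_mod_cast f2
    refine ⟨?_, f3⟩
    rw [f3] at f1
    have : (2 : ℂ) * n - m = 4 * gradeOf d := by linear_combination -2 * f1
    exact_mod_cast this
  · intro h
    constructor
    · ext d
      rw [coeff_virL0, coeff_smul, smul_eq_mul]
      by_cases hd : d ∈ v.support
      · obtain ⟨h1, h2⟩ := h d hd
        rw [h2]
        have : (2 : ℂ) * n - m = 4 * gradeOf d := by exact_mod_cast h1
        congr 1
        linear_combination -this / 2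
      · simp [notMem_support_iff.1 hd]
    · ext d
      rw [coeff_heis_zero, coeff_smul, smul_eq_mul]
      by_cases hd : d ∈ v.support
      · rw [(h d hd).2]
      · simp [notMem_support_iff.1 hd]

/-- The vectors of charge `m` and grade `N`. -/
noncomputable def gradedPiece (m N : ℤ) : Submodule ℂ Fock :=
  degreeSpace ((4 * N + m) / 2) ⊓ chargeSpace m

theorem gradedPiece_eq_restrictSupport (m N : ℤ) :
    gradedPiece m N = restrictSupport ℂ (monoSet m N) := by
  ext v
  rw [gradedPiece, mem_degree_charge_iff, mem_restrictSupport_iff]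
  refine forall₂_congr fun d _ => ?_
  have : 2 * ((4 * N + m) / 2 : ℚ) - m = 4 * N := by ring
  rw [this, monoSet, Set.mem_ofPred_eq, and_comm]
  refine and_congr_right fun _ => ?_
  constructor
  · intro h
    have : (N : ℚ) = gradeOf d := by linarith
    exact_mod_cast this.symm
  · intro h; rw [← h]; simp

theorem gradedPiece_eq_bot {m N : ℤ} (h : N < 0 ∨ m + N < 0) : gradedPiece m N = ⊥ := by
  rw [gradedPiece_eq_restrictSupport, monoSet_eq_empty h, eq_bot_iff]
  intro v hv
  rw [mem_restrictSupport_iff, Set.subset_empty_iff, Finset.coe_eq_empty, support_eq_empty] at hv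
  exact hv

theorem finrank_gradedPiece (m N : ℤ) :
    Module.finrank ℂ (gradedPiece m N) = (monoSet m N).ncard := by
  rw [gradedPiece_eq_restrictSupport,
    Module.finrank_eq_nat_card_basis (basisRestrictSupport ℂ (monoSet m N))]
  rfl

instance (m N : ℤ) : FiniteDimensional ℂ (gradedPiece m N) := by
  have := (monoSet_finite m N).to_subtype
  rw [gradedPiece_eq_restrictSupport]
  exact Module.Finite.of_basis (basisRestrictSupport ℂ (monoSet m N))

theorem heis_mem_gradedPiece (k m N : ℤ) {v : Fock} (hv : v ∈ gradedPiece m N) :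
    heis k v ∈ gradedPiece m (N - k) := by
  rw [gradedPiece, Submodule.mem_inf, degreeSpace, chargeSpace, Module.End.mem_eigenspace_iff,
    Module.End.mem_eigenspace_iff] at hv ⊢
  obtain ⟨h1, h2⟩ := hv
  constructor
  · rw [LinearMap.smul_apply] at h1 ⊢
    rw [virL0_heis, smul_sub, ← map_smul, h1, map_smul]
    push_cast
    module
  · rw [heis_zero_heis, h2, map_smul]

/-! ### Surjectivity of the annihilation operators -/

theorem pow_mul_of_commutator (a b : Module.End ℂ Fock) (c : ℂ) (h : a * b - b * a = c • 1)
    (s : ℕ) : a ^ (s + 1) * b = b * a ^ (s + 1) + ((s + 1) * c) • a ^ s := by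
  have h' : a * b = b * a + c • 1 := by rw [← h]; abel
  induction s with
  | zero => simp [h']
  | succ s ih =>
    rw [pow_succ' a (s + 1), mul_assoc, ih, mul_add, ← mul_assoc, h', add_mul, mul_smul_comm,
      ← pow_succ', smul_mul_assoc, one_mul, mul_assoc, ← pow_succ']
    push_cast
    module

/-- In a graded representation of the Weyl algebra with grades bounded below, the annihilation
operator is onto. -/
theorem exists_preimage_of_commutator (a b : Module.End ℂ Fock) (c : ℂ) (hc : c ≠ 0)
    (h : a * b - b * a = c • 1) (S : ℤ → Submodule ℂ Fock) (r : ℕ) (hr : 0 < r)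
    (ha : ∀ N, ∀ v ∈ S N, a v ∈ S (N - r)) (hb : ∀ N, ∀ v ∈ S N, b v ∈ S (N + r))
    (hS : ∀ N < 0, S N = ⊥) (N : ℤ) (v : Fock) (hv : v ∈ S N) : ∃ u ∈ S (N + r), a u = v := by
  have hnil : ∀ s : ℕ, ∀ N, ∀ v ∈ S N, (a ^ s) v ∈ S (N - s * r) := by
    intro s
    induction s with
    | zero => intro N v hv; simpa using hv
    | succ s ih =>
      intro N v hv
      rw [pow_succ', Module.End.mul_apply]
      have := ha _ _ (ih N v hv)
      rwa [show N - ((s + 1 : ℕ) : ℤ) * r = N - s * r - r by push_cast; ring]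
  -- Induction on the order of nilpotency: if `a^(s+1) v = 0`, then `a^s (a (b v)) = (s+1) c a^s v`,
  -- so subtracting a multiple of `a (b v)` from `v` leaves a vector killed by `a^s`.
  have key : ∀ s : ℕ, ∀ v ∈ S N, (a ^ s) v = 0 → ∃ u ∈ S (N + r), a u = v := by
    intro s
    induction s with
    | zero =>
      intro v _ h0
      exact ⟨0, Submodule.zero_mem _, by rw [map_zero]; simpa using h0.symm⟩
    | succ s ih =>
      intro v hv h0
      have hs : ((s : ℂ) + 1) * c ≠ 0 := mul_ne_zero (Nat.cast_add_one_ne_zero s) hc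
      have hab : a (b v) ∈ S N := by
        have := ha _ _ (hb _ _ hv)
        rwa [add_sub_cancel_right] at this
      obtain ⟨u, hu, hau⟩ := ih (v - (((s : ℂ) + 1) * c)⁻¹ • a (b v))
        ((S N).sub_mem hv ((S N).smul_mem _ hab)) (by
          have e := LinearMap.congr_fun (pow_mul_of_commutator a b c h s) v
          rw [Module.End.mul_apply, LinearMap.add_apply, Module.End.mul_apply, h0, map_zero,
            zero_add, pow_succ, Module.End.mul_apply, LinearMap.smul_apply] at e
          rw [map_sub, map_smul, e, smul_smul, inv_mul_cancel₀ hs, one_smul, sub_self])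
      refine ⟨u + (((s : ℂ) + 1) * c)⁻¹ • b v, Submodule.add_mem _ hu
        (Submodule.smul_mem _ _ (hb _ _ hv)), ?_⟩
      rw [map_add, hau, map_smul, sub_add_cancel]
  -- Since `r ≥ 1`, lowering `N.toNat + 1` times reaches a negative grade.
  refine key (N.toNat + 1) v hv ?_
  have := hnil (N.toNat + 1) N v hv
  rw [hS _ (by push_cast; nlinarith [Int.self_le_toNat N])] at this
  exact this

/-- The vectors of charge `m` and grade `N` killed by `h_1, …, h_r`. -/
noncomputable def partialHwv (r : ℕ) (m N : ℤ) : Submodule ℂ Fock :=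
  gradedPiece m N ⊓ ⨅ k : {k : ℕ // 0 < k ∧ k ≤ r}, LinearMap.ker (heis (k : ℕ))

theorem mem_partialHwv {r : ℕ} {m N : ℤ} {v : Fock} : v ∈ partialHwv r m N ↔
    v ∈ gradedPiece m N ∧ ∀ k : ℕ, 0 < k → k ≤ r → heis (k : ℤ) v = 0 := by
  simp [partialHwv]

instance (r : ℕ) (m N : ℤ) : FiniteDimensional ℂ (partialHwv r m N) :=
  Submodule.finiteDimensional_inf_left _ _

theorem partialHwv_zero (m N : ℤ) : partialHwv 0 m N = gradedPiece m N := by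
  ext v
  rw [mem_partialHwv]
  exact ⟨fun h => h.1, fun h => ⟨h, fun k h1 h2 => by omega⟩⟩

/-- Rank-nullity for `h_{r+1}`. It is onto because `h_{-(r+1)}` commutes with `h_1, …, h_r` and so
acts on their common kernel. -/
theorem finrank_partialHwv_succ (r : ℕ) (m N : ℤ) :
    Module.finrank ℂ (partialHwv (r + 1) m N) + Module.finrank ℂ (partialHwv r m (N - (r + 1 : ℕ))) =
      Module.finrank ℂ (partialHwv r m N) := by
  set a := heis ((r + 1 : ℕ) : ℤ) with ha
  set b := heis (-((r + 1 : ℕ) : ℤ)) with hb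
  have hab : a * b - b * a = (-((r + 1 : ℕ) : ℂ)) • 1 := by
    rw [ha, hb, heis_commutator_neg (by omega), if_pos rfl]
    simp
  have haS : ∀ N, ∀ v ∈ partialHwv r m N, a v ∈ partialHwv r m (N - (r + 1 : ℕ)) := by
    intro N v hv
    rw [mem_partialHwv] at hv ⊢
    refine ⟨heis_mem_gradedPiece _ _ _ hv.1, fun k h1 h2 => ?_⟩
    have := LinearMap.congr_fun (heis_commute_of_nonneg (m := k) (n := (r + 1 : ℕ)) (by omega)
      (by omega)) v
    rw [Module.End.mul_apply, Module.End.mul_apply, hv.2 k h1 h2, map_zero] at this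
    exact this
  have hbS : ∀ N, ∀ v ∈ partialHwv r m N, b v ∈ partialHwv r m (N + (r + 1 : ℕ)) := by
    intro N v hv
    rw [mem_partialHwv] at hv ⊢
    refine ⟨?_, fun k h1 h2 => ?_⟩
    · have := heis_mem_gradedPiece (-((r + 1 : ℕ) : ℤ)) _ _ hv.1
      rwa [sub_neg_eq_add] at this
    · have := LinearMap.congr_fun (heis_commutator_neg (m := k) (by omega) (r + 1)) v
      rw [if_neg (by omega), zero_smul, LinearMap.sub_apply, Module.End.mul_apply,
        Module.End.mul_apply, hv.2 k h1 h2, map_zero, sub_zero] at this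
      exact this
  have hrange : LinearMap.range (a.domRestrict (partialHwv r m N)) =
      partialHwv r m (N - (r + 1 : ℕ)) := by
    ext v
    constructor
    · rintro ⟨u, rfl⟩
      exact haS _ _ u.2
    · intro hv
      obtain ⟨u, hu, huv⟩ := exists_preimage_of_commutator a b _
        (neg_ne_zero.2 (Nat.cast_ne_zero.2 (Nat.succ_ne_zero r))) hab (partialHwv r m) (r + 1)
        (Nat.succ_pos r) haS hbS (fun N hN => by
          rw [partialHwv, gradedPiece_eq_bot (Or.inl hN), bot_inf_eq]) _ v hv
      rw [sub_add_cancel] at hu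
      exact ⟨⟨u, hu⟩, huv⟩
  have hle : partialHwv (r + 1) m N ≤ partialHwv r m N := fun v hv => by
    rw [mem_partialHwv] at hv ⊢
    exact ⟨hv.1, fun k h1 h2 => hv.2 k h1 (by omega)⟩
  have hker : LinearMap.ker (a.domRestrict (partialHwv r m N)) =
      (partialHwv (r + 1) m N).comap (partialHwv r m N).subtype := by
    ext v
    rw [LinearMap.mem_ker, LinearMap.domRestrict_apply, Submodule.mem_comap,
      Submodule.subtype_apply, mem_partialHwv]
    have hv := mem_partialHwv.1 v.2
    constructor
    · intro h
      refine ⟨hv.1, fun k h1 h2 => ?_⟩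
      rcases Nat.lt_or_ge r k with hk | hk
      · rw [show k = r + 1 by omega]; exact h
      · exact hv.2 k h1 hk
    · intro h
      exact h.2 (r + 1) (Nat.succ_pos r) le_rfl
  have := LinearMap.finrank_range_add_finrank_ker (a.domRestrict (partialHwv r m N))
  rw [hrange, hker, (Submodule.comapSubtypeEquivOfLe hle).finrank_eq] at this
  rw [← this, add_comm]

/-- For `k > N` the mode `h_k` sends grade `N` to a negative grade, so those conditions are
automatic. -/
theorem hwvDegreeCharge_eq_partialHwv (m : ℤ) (N r : ℕ) (h : N ≤ r) :
    hwvDegreeCharge ((4 * N + m) / 2) m = partialHwv r m N := by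
  ext v
  have e : hwvDegreeCharge ((4 * N + m) / 2) m = hwvSpace ⊓ gradedPiece m N := by
    rw [hwvDegreeCharge, inf_assoc, gradedPiece]
    push_cast
    rfl
  rw [e, mem_partialHwv, Submodule.mem_inf, and_comm]
  refine and_congr_right fun hv => ?_
  simp only [hwvSpace, Submodule.mem_iInf, LinearMap.mem_ker, Subtype.forall]
  constructor
  · intro H k h1 _
    exact H k (by omega)
  · intro H k hk
    obtain ⟨k, rfl⟩ := Int.eq_ofNat_of_zero_le hk.le
    rcases Nat.lt_or_ge r k with hkr | hkr
    · have := heis_mem_gradedPiece k _ _ hv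
      rw [gradedPiece_eq_bot (Or.inl (by omega))] at this
      exact this
    · exact H k (by omega) hkr

theorem hwvDegreeCharge_eq_bot (n : ℚ) (m : ℤ) (h : ∀ N : ℕ, 2 * n - m ≠ 4 * N) :
    hwvDegreeCharge n m = ⊥ := by
  rw [eq_bot_iff, hwvDegreeCharge, inf_assoc]
  rintro v ⟨-, hv⟩
  rw [SetLike.mem_coe, mem_degree_charge_iff] at hv
  rw [Submodule.mem_bot, ← support_eq_empty, Finset.eq_empty_iff_forall_notMem]
  exact fun d hd => h _ (hv d hd).1

/-! ### Generating functions of dimensions -/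

/-- The generating function of the dimensions of the graded pieces of charge `m`. -/
noncomputable def fockSeries (m : ℤ) : PowerSeries ℤ :=
  PowerSeries.mk fun N => ((monoSet m N).ncard : ℤ)

theorem coeff_prod_mul_fockSeries (r : ℕ) (m : ℤ) (N : ℕ) :
    PowerSeries.coeff N ((∏ i ∈ Finset.range r, (1 - PowerSeries.X ^ (i + 1) : PowerSeries ℤ)) * fockSeries m) =
      Module.finrank ℂ (partialHwv r m N) := by
  induction r generalizing N with
  | zero =>
    rw [Finset.prod_range_zero, one_mul, fockSeries, PowerSeries.coeff_mk, partialHwv_zero,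
      finrank_gradedPiece]
  | succ r ih =>
    have h := finrank_partialHwv_succ r m N
    rw [Finset.prod_range_succ, mul_right_comm, mul_sub, mul_one, map_sub, ih,
      PowerSeries.coeff_mul_X_pow', ← h]
    split_ifs with hN
    · rw [ih, Nat.cast_sub hN]; push_cast; ring
    · have hbot : partialHwv r m (N - (r + 1 : ℕ)) = ⊥ := by
        rw [partialHwv, gradedPiece_eq_bot (Or.inl (by omega)), bot_inf_eq]
      rw [hbot]; simp

end Dimensions

/-! ### The `q`-series identities: `q`-Vandermonde, Euler, Heine. -/

section QSeries

open PowerSeries Finset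

/-- The power series `∏_{i=1}^n (1 - q^i)⁻¹`. -/
noncomputable def invPoch : ℕ → ℤ⟦X⟧
  | 0 => 1
  | n + 1 => invPoch n * PowerSeries.invOfUnit (1 - X ^ (n + 1)) 1

theorem one_sub_X_pow_ne_zero (n : ℕ) : (1 - X ^ (n + 1) : ℤ⟦X⟧) ≠ 0 := by
  intro h
  have := congrArg (constantCoeff (R := ℤ)) h
  simp at this

theorem invPoch_succ (n : ℕ) : invPoch (n + 1) * (1 - X ^ (n + 1)) = invPoch n := by
  rw [invPoch, mul_assoc, mul_comm (invOfUnit _ _), PowerSeries.mul_invOfUnit, mul_one]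
  simp

theorem eq_invPoch_of_recurrence (f : ℕ → ℤ⟦X⟧) (h0 : f 0 = 1)
    (h : ∀ n, f (n + 1) * (1 - X ^ (n + 1)) = f n) (n : ℕ) : f n = invPoch n := by
  induction n with
  | zero => exact h0
  | succ n ih =>
    apply mul_right_cancel₀ (one_sub_X_pow_ne_zero n)
    rw [h, ih, invPoch_succ]

/-- A form of the `q`-Vandermonde summation. -/
theorem invPoch_mul_invPoch (n m : ℕ) : invPoch n * invPoch (n + m) =
    ∑ p ∈ antidiagonal n, X ^ (p.2 * (p.2 + m)) * invPoch p.2 * invPoch (p.2 + m) * invPoch p.1 := by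
  induction n generalizing m with
  | zero => simp [invPoch]
  | succ n ih =>
    apply mul_right_cancel₀ (one_sub_X_pow_ne_zero n)
    have hL : invPoch (n + 1) * invPoch (n + 1 + m) * (1 - X ^ (n + 1)) =
        invPoch n * invPoch (n + (m + 1)) := by
      rw [← invPoch_succ n, show n + (m + 1) = n + 1 + m by ring]; ring
    -- Writes `1 - q^(a+b)` as `(1 - q^b) + q^b (1 - q^a)`. Each bracket lowers one `invPoch`; after
    -- an index shift the two sums recombine into the case `n`, `m + 1`.
    have hsplit : ∀ p ∈ antidiagonal (n + 1),
        X ^ (p.2 * (p.2 + m)) * invPoch p.2 * invPoch (p.2 + m) * invPoch p.1 * (1 - X ^ (n + 1)) =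
        X ^ (p.2 * (p.2 + m)) * (invPoch p.2 * (1 - X ^ p.2)) * invPoch (p.2 + m) * invPoch p.1 +
        X ^ (p.2 * (p.2 + m) + p.2) * invPoch p.2 * invPoch (p.2 + m) *
          (invPoch p.1 * (1 - X ^ p.1)) := by
      intro p hp
      rw [← HasAntidiagonal.mem_antidiagonal.1 hp]
      ring
    rw [hL, ih, sum_mul, sum_congr rfl hsplit, sum_add_distrib, Nat.sum_antidiagonal_succ',
      Nat.sum_antidiagonal_succ]
    simp only [pow_zero, sub_self, mul_zero, zero_mul, zero_add, invPoch_succ]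
    rw [← sum_add_distrib]
    refine sum_congr rfl fun p _ => ?_
    rw [← invPoch_succ (p.2 + m), show p.2 + 1 + m = p.2 + m + 1 by ring,
      show p.2 + (m + 1) = p.2 + m + 1 by ring]
    ring

/-- The truncation of Euler's sum `∑ q^{s i} / (q)_i`. -/
noncomputable def eulerSum (K s : ℕ) : ℤ⟦X⟧ := ∑ i ∈ range K, X ^ (s * i) * invPoch i

/-- As `(1 - q^i)/(q)_i = 1/(q)_{i-1}`, the full sums satisfy `E(s) - E(s+1) = q^s E(s)`; truncation
leaves one term of order at least `K`. -/
theorem X_pow_dvd_eulerSum_succ (K s : ℕ) (hs : 1 ≤ s) :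
    X ^ K ∣ (1 - X ^ s) * eulerSum K s - eulerSum K (s + 1) := by
  cases K with
  | zero => simp
  | succ K =>
    have h1 : eulerSum (K + 1) (s + 1) =
        eulerSum (K + 1) s - X ^ s * ∑ i ∈ range K, X ^ (s * i) * invPoch i := by
      rw [eulerSum, eulerSum, sum_range_succ', sum_range_succ' (fun i => X ^ (s * i) * invPoch i),
        mul_sum, add_sub_right_comm, ← sum_sub_distrib]
      congr 1
      · refine sum_congr rfl fun i _ => ?_
        rw [← invPoch_succ i]
        ring
    have h2 : (1 - X ^ s) * eulerSum (K + 1) s - eulerSum (K + 1) (s + 1) =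
        -(X ^ (s + s * K) * invPoch K) := by
      rw [h1]
      have : eulerSum (K + 1) s = ∑ i ∈ range K, X ^ (s * i) * invPoch i + X ^ (s * K) * invPoch K :=
        sum_range_succ _ _
      rw [this]; ring
    rw [h2]
    refine ((pow_dvd_pow X ?_).mul_right _).neg_right
    nlinarith

theorem X_pow_dvd_prod_mul_eulerSum (K t : ℕ) :
    X ^ K ∣ (∏ r ∈ range t, (1 - X ^ (r + 2))) * eulerSum K 2 - eulerSum K (t + 2) := by
  induction t with
  | zero => simp
  | succ t ih =>
    have h := X_pow_dvd_eulerSum_succ K (t + 2) (by omega)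
    have := dvd_add (ih.mul_left (1 - X ^ (t + 2))) h
    convert this using 1
    rw [prod_range_succ]; ring

theorem X_pow_dvd_eulerSum_sub_one (K s : ℕ) (h : K ≤ s) (hK : 0 < K) :
    X ^ K ∣ eulerSum K s - 1 := by
  obtain ⟨K, rfl⟩ := Nat.exists_eq_succ_of_ne_zero hK.ne'
  rw [eulerSum, sum_range_succ']
  simp only [mul_zero, pow_zero, invPoch, one_mul, add_sub_cancel_right]
  refine dvd_sum fun i _ => (pow_dvd_pow X ?_).mul_right _
  nlinarith

/-- The truncated `q`-series identity behind the generating function of the crank: the limiting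
case of Heine's transformation. -/
theorem X_pow_dvd_heine (K m : ℕ) (hK : 0 < K) :
    X ^ K ∣ (∏ r ∈ range K, (1 - X ^ (r + 2))) *
        (∑ j ∈ range K, X ^ (2 * j) * invPoch j * invPoch (j + m)) -
      ∑ j ∈ range K, X ^ (2 * j + j * (j + m)) * invPoch j * invPoch (j + m) := by
  set Ps := ∑ j ∈ range K, X ^ (2 * j + j * (j + m)) * invPoch j * invPoch (j + m) with hPs
  set Pr := ∏ r ∈ range K, (1 - X ^ (r + 2) : ℤ⟦X⟧)
  -- By `invPoch_mul_invPoch` the subtracted sum runs over the pairs with `p.1 + p.2 < K`; the other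
  -- pairs of the product have order at least `K`.
  have h1 : X ^ K ∣ Ps * eulerSum K 2 -
      ∑ j ∈ range K, X ^ (2 * j) * invPoch j * invPoch (j + m) := by
    have hA : ∑ j ∈ range K, X ^ (2 * j) * invPoch j * invPoch (j + m) =
        ∑ p ∈ (range K ×ˢ range K) with p.1 + p.2 < K,
          (X ^ (2 * p.2 + p.2 * (p.2 + m)) * invPoch p.2 * invPoch (p.2 + m)) *
            (X ^ (2 * p.1) * invPoch p.1) := by
      have hB : ((range K ×ˢ range K).filter fun p => p.1 + p.2 < K) =
          (range K).biUnion fun n => antidiagonal n := by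
        ext p
        simp only [mem_filter, mem_product, mem_range, mem_biUnion, HasAntidiagonal.mem_antidiagonal]
        constructor
        · rintro ⟨_, h⟩; exact ⟨_, h, rfl⟩
        · rintro ⟨n, h, rfl⟩; omega
      rw [hB, sum_biUnion]
      · refine sum_congr rfl fun n _ => ?_
        rw [mul_assoc, invPoch_mul_invPoch, mul_sum]
        refine sum_congr rfl fun p hp => ?_
        rw [← HasAntidiagonal.mem_antidiagonal.1 hp]
        ring
      · intro a _ b _ hab
        rw [Function.onFun, disjoint_left]
        intro p hp hq
        exact hab ((HasAntidiagonal.mem_antidiagonal.1 hp).symm.trans (HasAntidiagonal.mem_antidiagonal.1 hq))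
    have hC : Ps * eulerSum K 2 = ∑ p ∈ range K ×ˢ range K,
          (X ^ (2 * p.2 + p.2 * (p.2 + m)) * invPoch p.2 * invPoch (p.2 + m)) *
            (X ^ (2 * p.1) * invPoch p.1) := by
      rw [hPs, eulerSum, sum_mul_sum, sum_comm, sum_product]
    rw [hA, hC, ← sum_filter_add_sum_filter_not (range K ×ˢ range K) (fun p => p.1 + p.2 < K),
      add_sub_cancel_left]
    refine dvd_sum fun p hp => ?_
    have : K ≤ p.1 + p.2 := by simpa using (mem_filter.1 hp).2
    have e : (X ^ (2 * p.2 + p.2 * (p.2 + m)) * invPoch p.2 * invPoch (p.2 + m)) *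
            (X ^ (2 * p.1) * invPoch p.1) = X ^ (2 * p.2 + p.2 * (p.2 + m) + 2 * p.1) *
            (invPoch p.2 * invPoch (p.2 + m) * invPoch p.1) := by ring
    rw [e]
    refine (pow_dvd_pow X ?_).mul_right _
    have := Nat.zero_le (p.2 * (p.2 + m))
    omega
  have h2 := X_pow_dvd_prod_mul_eulerSum K K
  have h3 := X_pow_dvd_eulerSum_sub_one K (K + 2) (by omega) hK
  -- Modulo `X ^ K`, `Pr * eulerSum K 2` is `1`, so multiplying `h1` by `Pr` clears Euler's sum.
  have := dvd_sub ((dvd_add h2 h3).mul_left Ps) (h1.mul_left Pr)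
  convert this using 1
  ring

end QSeries

/-! ### Weight generating functions of families of multisets. -/

section Weights

open PowerSeries

/-! ### Weight generating functions -/

/-- The generating function of a weight with finite fibres. -/
noncomputable def wtSeries {α : Type*} (w : α → ℕ) : ℤ⟦X⟧ :=
  PowerSeries.mk fun N => (Nat.card {a // w a = N} : ℤ)

theorem wtSeries_equiv {α β : Type*} {w : α → ℕ} {w' : β → ℕ} (e : α ≃ β)
    (h : ∀ a, w' (e a) = w a) : wtSeries w = wtSeries w' := by
  ext N
  simp only [wtSeries, coeff_mk]
  congr 1
  exact Nat.card_congr (e.subtypeEquiv fun a => by rw [h])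

theorem wtSeries_bijective {α β : Type*} {w : α → ℕ} {w' : β → ℕ} {f : α → β}
    (hf : f.Bijective) (h : ∀ a, w' (f a) = w a) : wtSeries w = wtSeries w' :=
  wtSeries_equiv (Equiv.ofBijective f hf) h

theorem wtSeries_sum {α β : Type*} {w : α → ℕ} {w' : β → ℕ}
    (hw : ∀ N, Finite {a // w a = N}) (hw' : ∀ N, Finite {a // w' a = N}) :
    wtSeries (Sum.elim w w') = wtSeries w + wtSeries w' := by
  ext N
  simp only [wtSeries, coeff_mk, map_add]
  have := hw N
  have := hw' N
  rw [← Nat.cast_add, ← Nat.card_sum]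
  congr 1
  exact Nat.card_congr (Equiv.subtypeSum (p := fun a => Sum.elim w w' a = N))

theorem wtSeries_prod {α β : Type*} {w : α → ℕ} {w' : β → ℕ}
    (hw : ∀ N, Finite {a // w a = N}) (hw' : ∀ N, Finite {a // w' a = N}) :
    wtSeries (fun p : α × β => w p.1 + w' p.2) = wtSeries w * wtSeries w' := by
  ext N
  simp only [wtSeries, coeff_mk, coeff_mul]
  let e : {p : α × β // w p.1 + w' p.2 = N} ≃
      Σ q : Finset.HasAntidiagonal.antidiagonal N, {a // w a = q.1.1} × {b // w' b = q.1.2} :=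
    { toFun := fun p => ⟨⟨(w p.1.1, w' p.1.2), Finset.HasAntidiagonal.mem_antidiagonal.2 p.2⟩,
        ⟨p.1.1, rfl⟩, ⟨p.1.2, rfl⟩⟩
      invFun := fun q => ⟨(q.2.1.1, q.2.2.1), by
        have := Finset.HasAntidiagonal.mem_antidiagonal.1 q.1.2
        rw [q.2.1.2, q.2.2.2, this]⟩
      left_inv := fun p => rfl
      right_inv := by
        rintro ⟨⟨⟨x, y⟩, hq⟩, ⟨a, ha⟩, ⟨b, hb⟩⟩
        dsimp only at ha hb
        subst ha hb
        rfl }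
  have : ∀ q : Finset.HasAntidiagonal.antidiagonal N,
      Finite ({a // w a = q.1.1} × {b // w' b = q.1.2}) := fun q => by
    have := hw q.1.1
    have := hw' q.1.2
    infer_instance
  rw [Nat.card_congr e, Nat.card_sigma]
  simp only [Nat.card_prod]
  push_cast
  rw [Finset.sum_coe_sort (Finset.HasAntidiagonal.antidiagonal N)
    (fun q => (Nat.card {a // w a = q.1} : ℤ) * (Nat.card {b // w' b = q.2} : ℤ))]

theorem wtSeries_add_const {α : Type*} (w : α → ℕ) (k : ℕ) :
    wtSeries (fun a => w a + k) = X ^ k * wtSeries w := by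
  ext N
  rw [coeff_X_pow_mul']
  simp only [wtSeries, coeff_mk]
  split_ifs with h
  · congr 1
    exact Nat.card_congr (Equiv.subtypeEquivRight fun a => by omega)
  · have : IsEmpty {a // w a + k = N} := ⟨fun a => h (by have := a.2; omega)⟩
    simp

theorem wtSeries_unique {α : Type*} [Unique α] (w : α → ℕ) (h : w default = 0) :
    wtSeries w = 1 := by
  ext N
  rw [wtSeries, coeff_mk, coeff_one]
  split_ifs with hN
  · subst hN
    have : Unique {a // w a = 0} :=
      ⟨⟨⟨default, h⟩⟩, fun a => Subtype.ext (Subsingleton.elim _ _)⟩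
    simp
  · have : IsEmpty {a // w a = N} :=
      ⟨fun a => hN (by rw [← a.2, Subsingleton.elim a.1 default, h])⟩
    simp

/-! ### Multisets of natural numbers -/

theorem finite_multiset_card_sum (A B : ℕ) :
    {s : Multiset ℕ | s.card ≤ A ∧ s.sum ≤ B}.Finite := by
  refine (Set.finite_Iic (A • Multiset.range (B + 1))).subset ?_
  rintro s ⟨h1, h2⟩
  rw [Set.mem_Iic, Multiset.le_iff_count]
  intro a
  by_cases ha : a ∈ s
  · have : a ≤ B := (Multiset.le_sum_of_mem ha).trans h2
    rw [Multiset.count_nsmul, Multiset.count_eq_one_of_mem (Multiset.nodup_range _)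
      (Multiset.mem_range.2 (by omega)), mul_one]
    exact (Multiset.count_le_card a s).trans h1
  · rw [Multiset.count_eq_zero_of_notMem ha]; exact Nat.zero_le _

theorem card_le_sum_of_pos {s : Multiset ℕ} (h : ∀ x ∈ s, 0 < x) : s.card ≤ s.sum := by
  have := Multiset.card_nsmul_le_sum (s := s) (a := 1) h
  simpa using this

/-- If every element of `a`, `a'` satisfies `p` and no element of `b`, `b'` does, then
`a + b = a' + b'` only if `a = a'` and `b = b'`. -/
theorem add_eq_add_of_filter {α : Type*} {p : α → Prop} {a b a' b' : Multiset α}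
    (ha : ∀ x ∈ a, p x) (ha' : ∀ x ∈ a', p x) (hb : ∀ x ∈ b, ¬ p x) (hb' : ∀ x ∈ b', ¬ p x)
    (h : a + b = a' + b') : a = a' ∧ b = b' := by
  classical
  have h1 := congrArg (Multiset.filter p) h
  rw [Multiset.filter_add, Multiset.filter_add, Multiset.filter_eq_self.2 ha,
    Multiset.filter_eq_self.2 ha', Multiset.filter_eq_nil.2 hb, Multiset.filter_eq_nil.2 hb',
    add_zero, add_zero] at h1
  subst h1
  exact ⟨rfl, add_left_cancel h⟩

/-- Multisets of natural numbers with `i` elements. -/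
abbrev SizedMultiset (i : ℕ) : Type := {s : Multiset ℕ // s.card = i}

theorem finite_sizedMultiset (i N : ℕ) : Finite {s : SizedMultiset i // s.1.sum = N} := by
  have := (finite_multiset_card_sum i N).to_subtype
  exact Finite.of_injective (β := {s : Multiset ℕ | s.card ≤ i ∧ s.sum ≤ N})
    (fun s => ⟨s.1.1, s.1.2.le, s.2.le⟩) fun s t h => by
      have h' := congrArg Subtype.val h
      exact Subtype.ext (Subtype.ext h')

/-- Either `0` occurs and one copy is removed, or every element can be lowered by `1`, at a total
cost equal to the size. This is the recurrence of `invPoch`. -/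
theorem wtSeries_sizedMultiset (i : ℕ) :
    wtSeries (fun s : SizedMultiset i => s.1.sum) = invPoch i := by
  refine eq_invPoch_of_recurrence (fun i => wtSeries fun s : SizedMultiset i => s.1.sum) ?_ ?_ i
  · let u : Unique (SizedMultiset 0) :=
      ⟨⟨⟨0, rfl⟩⟩, fun s => Subtype.ext (Multiset.card_eq_zero.1 s.2)⟩
    exact wtSeries_unique _ rfl
  · intro i
    let f : SizedMultiset i ⊕ SizedMultiset (i + 1) → SizedMultiset (i + 1) :=
      Sum.elim (fun t => ⟨0 ::ₘ t.1, by rw [Multiset.card_cons, t.2]⟩)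
        (fun t => ⟨t.1.map Nat.succ, by rw [Multiset.card_map, t.2]⟩)
    have hf : f.Bijective := by
      constructor
      · rintro (s | s) (t | t) h <;> have h' := congrArg Subtype.val h <;>
          simp only [f, Sum.elim_inl, Sum.elim_inr] at h'
        · rw [Multiset.cons_inj_right] at h'
          rw [Subtype.ext h']
        · have : 0 ∈ t.1.map Nat.succ := h' ▸ Multiset.mem_cons_self _ _
          simp at this
        · have : 0 ∈ s.1.map Nat.succ := h' ▸ Multiset.mem_cons_self _ _
          simp at this
        · rw [Subtype.ext (Multiset.map_injective Nat.succ_injective h')]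
      · rintro ⟨s, hs⟩
        by_cases h0 : 0 ∈ s
        · obtain ⟨t, rfl⟩ := Multiset.exists_cons_of_mem h0
          exact ⟨Sum.inl ⟨t, by simpa using hs⟩, rfl⟩
        · refine ⟨Sum.inr ⟨s.map Nat.pred, by simpa using hs⟩, Subtype.ext ?_⟩
          simp only [f, Sum.elim_inr, Multiset.map_map]
          conv_rhs => rw [← Multiset.map_id s]
          refine Multiset.map_congr rfl fun x hx => ?_
          exact Nat.succ_pred (fun h => h0 (h ▸ hx))
    have hw : ∀ a, (f a).1.sum = Sum.elim (fun s : SizedMultiset i => s.1.sum)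
        (fun s : SizedMultiset (i + 1) => s.1.sum + (i + 1)) a := by
      rintro (s | s)
      · simp [f]
      · have := s.2
        simp only [f, Sum.elim_inr, Nat.succ_eq_add_one, Multiset.sum_map_add, Multiset.map_id',
          Multiset.map_const', Multiset.sum_replicate, this]
        simp
    have hfin : ∀ N, Finite {s : SizedMultiset (i + 1) // s.1.sum + (i + 1) = N} := fun N => by
      have := finite_sizedMultiset (i + 1) (N - (i + 1))
      exact Finite.of_injective (β := {s : SizedMultiset (i + 1) // s.1.sum = N - (i + 1)})
        (fun s => ⟨s.1, by have := s.2; omega⟩) fun s t h => by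
          have h' := congrArg Subtype.val h
          exact Subtype.ext h'
    have h := wtSeries_bijective (w' := fun s : SizedMultiset (i + 1) => s.1.sum) hf hw
    rw [wtSeries_sum (finite_sizedMultiset i) hfin, wtSeries_add_const] at h
    rw [mul_sub, mul_one, sub_eq_iff_eq_add, mul_comm _ (X ^ _)]
    exact h.symm

/-- Multisets of integers between `2` and `j`. -/
abbrev BoundedMultiset (j : ℕ) : Type := {s : Multiset ℕ // ∀ x ∈ s, 2 ≤ x ∧ x ≤ j}

theorem finite_boundedMultiset (j k N : ℕ) :
    Finite {s : BoundedMultiset j // s.1.sum + k = N} := by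
  have := (finite_multiset_card_sum N N).to_subtype
  refine Finite.of_injective (β := {s : Multiset ℕ | s.card ≤ N ∧ s.sum ≤ N})
    (fun s => ⟨s.1.1, ?_, ?_⟩) fun s t h => by
      have h' := congrArg Subtype.val h
      exact Subtype.ext (Subtype.ext h')
  · have := card_le_sum_of_pos fun x hx => two_pos.trans_le (s.1.2 x hx).1
    have := s.2
    omega
  · have := s.2
    omega

theorem wtSeries_boundedMultiset_succ (j : ℕ) :
    wtSeries (fun s : BoundedMultiset (j + 2) => s.1.sum) * (1 - X ^ (j + 2)) =
      wtSeries fun s : BoundedMultiset (j + 1) => s.1.sum := by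
  let f : BoundedMultiset (j + 1) ⊕ BoundedMultiset (j + 2) → BoundedMultiset (j + 2) :=
    Sum.elim (fun t => ⟨t.1, fun x hx => ⟨(t.2 x hx).1, (t.2 x hx).2.trans (Nat.le_succ _)⟩⟩)
      (fun t => ⟨(j + 2) ::ₘ t.1, fun x hx => by
        rcases Multiset.mem_cons.1 hx with rfl | hx
        · omega
        · exact t.2 x hx⟩)
  have hf : f.Bijective := by
    constructor
    · rintro (s | s) (t | t) h <;> have h' := congrArg Subtype.val h <;>
        simp only [f, Sum.elim_inl, Sum.elim_inr] at h'
      · rw [Subtype.ext h']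
      · have := (s.2 (j + 2) (h' ▸ Multiset.mem_cons_self _ _)).2
        omega
      · have := (t.2 (j + 2) (h' ▸ Multiset.mem_cons_self _ _)).2
        omega
      · rw [Multiset.cons_inj_right] at h'
        rw [Subtype.ext h']
    · rintro ⟨s, hs⟩
      by_cases h0 : j + 2 ∈ s
      · obtain ⟨t, rfl⟩ := Multiset.exists_cons_of_mem h0
        exact ⟨Sum.inr ⟨t, fun x hx => hs x (Multiset.mem_cons_of_mem hx)⟩, rfl⟩
      · refine ⟨Sum.inl ⟨s, fun x hx => ⟨(hs x hx).1, ?_⟩⟩, rfl⟩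
        have := (hs x hx).2
        have : x ≠ j + 2 := fun h => h0 (h ▸ hx)
        omega
  have hw : ∀ a, (f a).1.sum = Sum.elim (fun s : BoundedMultiset (j + 1) => s.1.sum)
      (fun s : BoundedMultiset (j + 2) => s.1.sum + (j + 2)) a := by
    rintro (s | s)
    · rfl
    · simp [f, add_comm]
  have h := wtSeries_bijective (w' := fun s : BoundedMultiset (j + 2) => s.1.sum) hf hw
  rw [wtSeries_sum (w := fun s : BoundedMultiset (j + 1) => s.1.sum) (finite_boundedMultiset (j + 1) 0)
    (finite_boundedMultiset (j + 2) (j + 2)), wtSeries_add_const] at h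
  rw [mul_sub, mul_one, sub_eq_iff_eq_add, mul_comm _ (X ^ _)]
  exact h.symm

theorem wtSeries_boundedMultiset (j : ℕ) :
    wtSeries (fun s : BoundedMultiset (j + 1) => s.1.sum) = (1 - X) * invPoch (j + 1) := by
  induction j with
  | zero =>
    let u : Unique (BoundedMultiset (0 + 1)) :=
      ⟨⟨⟨0, by simp⟩⟩, fun s => Subtype.ext (Multiset.eq_zero_of_forall_notMem fun x hx => by
        have := s.2 x hx; omega)⟩
    rw [wtSeries_unique _ rfl, mul_comm]
    have := invPoch_succ 0
    rw [zero_add, pow_one] at this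
    exact this.symm
  | succ j ih =>
    apply mul_right_cancel₀ (one_sub_X_pow_ne_zero (j + 1))
    rw [mul_assoc, invPoch_succ, ← ih]
    exact wtSeries_boundedMultiset_succ j

end Weights

/-! ### Series for monomials and for partitions of given crank. -/

section Counting

open PowerSeries

/-! ### Monomials of given charge and grade -/

theorem toFinsupp_sum_smul {A : Type*} [AddCommMonoid A] (f : ℕ → A) (s : Multiset ℕ) :
    ((Multiset.toFinsupp s).sum fun k e => e • f k) = (s.map f).sum := by
  induction s using Multiset.induction with
  | empty => simp
  | cons a s ih =>
    rw [← Multiset.singleton_add, map_add, Finsupp.sum_add_index' (by simp)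
      (by intros; rw [add_smul]), ih, Multiset.toFinsupp_singleton,
      Finsupp.sum_single_index (by simp), one_smul, Multiset.map_add, Multiset.sum_add,
      Multiset.map_singleton, Multiset.sum_singleton]

/-- The monomial with even-indexed factors `a` and odd-indexed factors `b`. -/
noncomputable def interleave (p : Multiset ℕ × Multiset ℕ) : ℕ →₀ ℕ :=
  Multiset.toFinsupp (p.1.map (fun k => 2 * k) + p.2.map (fun k => 2 * k + 1))

theorem interleave_bijective : interleave.Bijective := by
  have inj0 : Function.Injective fun k => 2 * k := fun a b h => by simp only at h; omega
  have inj1 : Function.Injective fun k => 2 * k + 1 := fun a b h => by simp only at h; omega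
  constructor
  · rintro ⟨a, b⟩ ⟨a', b'⟩ h
    have h' := Multiset.toFinsupp.injective h
    have hA : ∀ a : Multiset ℕ, ∀ x ∈ a.map (fun k => 2 * k), x % 2 = 0 := by
      intro a x hx
      obtain ⟨k, -, rfl⟩ := Multiset.mem_map.1 hx
      omega
    have hB : ∀ a : Multiset ℕ, ∀ x ∈ a.map (fun k => 2 * k + 1), ¬ x % 2 = 0 := by
      intro a x hx
      obtain ⟨k, -, rfl⟩ := Multiset.mem_map.1 hx
      omega
    obtain ⟨h1, h2⟩ := add_eq_add_of_filter (hA a) (hA a') (hB b) (hB b') h'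
    rw [Multiset.map_injective inj0 h1, Multiset.map_injective inj1 h2]
  · intro d
    obtain ⟨s, rfl⟩ := Multiset.toFinsupp.surjective d
    refine ⟨((s.filter fun x => x % 2 = 0).map (· / 2),
      (s.filter fun x => ¬ x % 2 = 0).map (· / 2)), ?_⟩
    rw [interleave]
    congr 1
    conv_rhs => rw [← Multiset.filter_add_not (fun x => x % 2 = 0) s]
    simp only [Multiset.map_map]
    congr 1
    · conv_rhs => rw [← Multiset.map_id (s.filter fun x => x % 2 = 0)]
      refine Multiset.map_congr rfl fun x hx => ?_
      have := (Multiset.mem_filter.1 hx).2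
      simp only [Function.comp_apply, id]
      omega
    · conv_rhs => rw [← Multiset.map_id (s.filter fun x => ¬ x % 2 = 0)]
      refine Multiset.map_congr rfl fun x hx => ?_
      have := (Multiset.mem_filter.1 hx).2
      simp only [Function.comp_apply, id]
      omega

theorem chargeOf_interleave (p : Multiset ℕ × Multiset ℕ) :
    chargeOf (interleave p) = p.1.card - p.2.card := by
  have h := toFinsupp_sum_smul (fun k => (-1 : ℤ) ^ k)
    (p.1.map (fun k => 2 * k) + p.2.map (fun k => 2 * k + 1))
  simp only [nsmul_eq_mul] at h
  rw [chargeOf, interleave, h]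
  simp [Multiset.map_map, pow_succ, sub_eq_add_neg]

theorem gradeOf_interleave (p : Multiset ℕ × Multiset ℕ) :
    gradeOf (interleave p) = p.1.sum + p.2.sum + p.2.card := by
  have h := toFinsupp_sum_smul (fun k => (k + 1) / 2)
    (p.1.map (fun k => 2 * k) + p.2.map (fun k => 2 * k + 1))
  simp only [smul_eq_mul] at h
  rw [gradeOf, interleave, h]
  have e0 : ∀ k, (2 * k + 1) / 2 = k := by omega
  have e1 : ∀ k, (2 * k + 1 + 1) / 2 = k + 1 := by omega
  simp only [Multiset.map_add, Multiset.map_map, Function.comp_def, e0, e1, Multiset.sum_add,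
    Multiset.sum_map_add, Multiset.map_id', Multiset.map_const', Multiset.sum_replicate]
  simp [add_assoc]

/-- `1 / (q)_z` for an integer `z`, which is `0` for `z < 0`. -/
noncomputable def invPochInt (z : ℤ) : ℤ⟦X⟧ := if 0 ≤ z then invPoch z.toNat else 0

/-- Here `j` counts the odd variables; the factor `X ^ j` arises because `X (2k+1)` has grade `k +
1` while `X (2k)` has grade `k`. -/
theorem natCard_monomials (m : ℤ) (j N : ℕ) :
    (Nat.card {p : Multiset ℕ × Multiset ℕ // p.2.card = j ∧ (p.1.card : ℤ) = m + j ∧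
      p.1.sum + p.2.sum + p.2.card = N} : ℤ) =
    coeff N (X ^ j * (invPoch j * invPochInt (m + j))) := by
  unfold invPochInt
  split_ifs with h
  · rw [mul_comm (invPoch j), ← wtSeries_sizedMultiset, ← wtSeries_sizedMultiset,
      ← wtSeries_prod (finite_sizedMultiset _) (finite_sizedMultiset _), ← wtSeries_add_const,
      wtSeries, coeff_mk]
    congr 1
    refine Nat.card_congr ⟨fun p => ⟨(⟨p.1.1, ?_⟩, ⟨p.1.2, p.2.1⟩), ?_⟩,
      fun p => ⟨(p.1.1.1, p.1.2.1), p.1.2.2, ?_, ?_⟩, fun _ => rfl, fun _ => rfl⟩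
    · have := p.2; omega
    · have := p.2; simp only; omega
    · have := p.1.1.2; simp only; omega
    · have := p.1.2.2; have := p.2; simp only; omega
  · have : IsEmpty {p : Multiset ℕ × Multiset ℕ // p.2.card = j ∧ (p.1.card : ℤ) = m + j ∧
      p.1.sum + p.2.sum + p.2.card = N} := ⟨fun p => by have := p.2.2.1; omega⟩
    simp

theorem card_eq_sum_card_fiber {α : Type*} {P : α → Prop} (hP : Finite {a // P a}) (f : α → ℕ)
    (K : ℕ) (hf : ∀ a, P a → f a < K) :
    Nat.card {a // P a} = ∑ j ∈ Finset.range K, Nat.card {a // f a = j ∧ P a} := by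
  have e : {a // P a} ≃ Σ j : Fin K, {a // f a = j ∧ P a} :=
    { toFun := fun a => ⟨⟨f a, hf a a.2⟩, a, rfl, a.2⟩
      invFun := fun a => ⟨a.2.1, a.2.2.2⟩
      left_inv := fun _ => rfl
      right_inv := by
        rintro ⟨⟨j, hj⟩, ⟨a, ha, ha'⟩⟩
        dsimp only at ha
        subst ha
        rfl }
  have : ∀ j : Fin K, Finite {a // f a = j ∧ P a} := fun j =>
    Finite.of_injective (β := {a // P a}) (fun a => ⟨a.1, a.2.2⟩) fun a b h => by
      have h' := congrArg Subtype.val h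
      exact Subtype.ext h'
  rw [Nat.card_congr e, Nat.card_sigma, Finset.sum_range]

theorem coeff_fockSeries (m : ℤ) (K N : ℕ) (h : N < K) :
    coeff N (fockSeries m) =
      coeff N (∑ j ∈ Finset.range K, X ^ j * (invPoch j * invPochInt (m + j))) := by
  let e := Equiv.ofBijective _ interleave_bijective
  let e' : {p : Multiset ℕ × Multiset ℕ // (p.1.card : ℤ) = m + p.2.card ∧
      p.1.sum + p.2.sum + p.2.card = N} ≃ monoSet m N := e.subtypeEquiv fun p => by
    change _ ↔ chargeOf (interleave p) = m ∧ (gradeOf (interleave p) : ℤ) = N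
    rw [chargeOf_interleave, gradeOf_interleave]
    omega
  have := (monoSet_finite m N).to_subtype
  rw [fockSeries, coeff_mk, map_sum, ← Nat.card_coe_set_eq, ← Nat.card_congr e',
    card_eq_sum_card_fiber (Finite.of_equiv _ e'.symm) (fun p => p.2.card) K fun p hp => by omega]
  push_cast
  refine Finset.sum_congr rfl fun j _ => ?_
  rw [← natCard_monomials]
  congr 1
  refine Nat.card_congr (Equiv.subtypeEquivRight fun p => and_congr_right fun hp => ?_)
  rw [hp]

/-! ### Partitions of given crank -/

/-- Multisets of positive integers with `j` ones and `i` parts larger than `j`. -/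
abbrev OnesMultiset (j i : ℕ) : Type :=
  {s : Multiset ℕ // (∀ x ∈ s, 0 < x) ∧ s.count 1 = j ∧ (s.filter fun a => j < a).card = i}

/-- Splits off the `j` ones and the `i` parts above `j`, each lowered by `j + 1`; parts from `2` to
`j` remain. Positivity of `j` keeps the ones out of the large parts. -/
theorem wtSeries_onesMultiset (j i : ℕ) (hj : 0 < j) :
    wtSeries (fun s : OnesMultiset j i => s.1.sum) =
      X ^ (j + i * (j + 1)) * ((1 - X) * invPoch j * invPoch i) := by
  have inj : Function.Injective fun k => k + (j + 1) := fun a b h => by simp only at h; omega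
  have hB : ∀ u : Multiset ℕ, ∀ x ∈ u.map fun k => k + (j + 1), j < x := by
    intro u x hx
    obtain ⟨k, -, rfl⟩ := Multiset.mem_map.1 hx
    omega
  have hA : ∀ t : BoundedMultiset j, ∀ x ∈ Multiset.replicate j 1 + t.1, ¬ j < x := by
    intro t x hx
    rcases Multiset.mem_add.1 hx with hx | hx
    · have := Multiset.eq_of_mem_replicate hx
      omega
    · have := t.2 x hx
      omega
  let f : BoundedMultiset j × SizedMultiset i → OnesMultiset j i := fun p =>
    ⟨p.2.1.map (fun k => k + (j + 1)) + (Multiset.replicate j 1 + p.1.1), by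
      refine ⟨fun x hx => ?_, ?_, ?_⟩
      · rcases Multiset.mem_add.1 hx with hx | hx
        · have := hB _ _ hx
          omega
        · rcases Multiset.mem_add.1 hx with hx | hx
          · rw [Multiset.eq_of_mem_replicate hx]; exact one_pos
          · have := p.1.2 x hx
            omega
      · rw [Multiset.count_add, Multiset.count_add, Multiset.count_replicate_self,
          Multiset.count_eq_zero_of_notMem, Multiset.count_eq_zero_of_notMem]
        · omega
        · intro hx
          have := p.1.2 1 hx
          omega
        · intro hx
          have := hB _ _ hx
          omega
      · rw [Multiset.filter_add, Multiset.filter_eq_self.2 (hB _),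
          Multiset.filter_eq_nil.2 (hA _), add_zero, Multiset.card_map, p.2.2]⟩
  have hf : f.Bijective := by
    constructor
    · rintro ⟨t, u⟩ ⟨t', u'⟩ h
      have h' := congrArg Subtype.val h
      obtain ⟨h1, h2⟩ := add_eq_add_of_filter (hB u) (hB u') (hA t) (hA t') h'
      rw [Subtype.ext (Multiset.map_injective inj h1), Subtype.ext (add_left_cancel h2)]
    · rintro ⟨s, hs, h1, hi⟩
      refine ⟨(⟨s.filter fun x => 2 ≤ x ∧ x ≤ j, fun x hx => (Multiset.mem_filter.1 hx).2⟩,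
        ⟨(s.filter fun x => j < x).map fun x => x - (j + 1), by rw [Multiset.card_map, hi]⟩),
        Subtype.ext ?_⟩
      simp only [f, Multiset.map_map]
      conv_rhs => rw [← Multiset.filter_add_not (fun x => j < x) s]
      congr 1
      · conv_rhs => rw [← Multiset.map_id (s.filter fun x => j < x)]
        refine Multiset.map_congr rfl fun x hx => ?_
        have := (Multiset.mem_filter.1 hx).2
        simp only [Function.comp_apply, id]
        omega
      · conv_rhs => rw [← Multiset.filter_add_not (fun x => x = 1)
          (s.filter fun x => ¬ j < x)]
        rw [Multiset.filter_filter, Multiset.filter_filter]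
        congr 1
        · rw [← h1, ← Multiset.filter_eq' s 1]
          refine Multiset.filter_congr fun x _ => ?_
          omega
        · refine Multiset.filter_congr fun x hx => ?_
          have := hs x hx
          omega
  have hw : ∀ a, (f a).1.sum = a.1.1.sum + a.2.1.sum + (j + i * (j + 1)) := by
    rintro ⟨t, u⟩
    have := u.2
    simp only [f, Multiset.sum_add, Multiset.sum_map_add, Multiset.map_id', Multiset.map_const',
      Multiset.sum_replicate, this, smul_eq_mul, mul_one]
    ring
  obtain ⟨j, rfl⟩ := Nat.exists_eq_succ_of_ne_zero hj.ne'
  rw [← wtSeries_boundedMultiset, ← wtSeries_sizedMultiset, ← wtSeries_prod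
    (w := fun s : BoundedMultiset (j + 1) => s.1.sum)
    (finite_boundedMultiset _ 0) (finite_sizedMultiset _), ← wtSeries_add_const]
  exact (wtSeries_bijective (w' := fun s : OnesMultiset (j + 1) i => s.1.sum) hf hw).symm

/-- Multisets of integers `≥ 2` with largest element `m`. -/
abbrev NoOnesMultiset (m : ℕ) : Type :=
  {s : Multiset ℕ // (∀ x ∈ s, 0 < x) ∧ s.count 1 = 0 ∧ s.sup = m}

theorem wtSeries_noOnesMultiset (m : ℕ) :
    wtSeries (fun s : NoOnesMultiset (m + 2) => s.1.sum) =
      X ^ (m + 2) * ((1 - X) * invPoch (m + 2)) := by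
  let f : BoundedMultiset (m + 2) → NoOnesMultiset (m + 2) := fun t =>
    ⟨(m + 2) ::ₘ t.1, by
      refine ⟨fun x hx => ?_, ?_, ?_⟩
      · rcases Multiset.mem_cons.1 hx with rfl | hx
        · omega
        · have := t.2 x hx
          omega
      · rw [Multiset.count_eq_zero]
        intro hx
        rcases Multiset.mem_cons.1 hx with hx | hx
        · omega
        · have := t.2 1 hx
          omega
      · rw [Multiset.sup_cons, sup_eq_left, Multiset.sup_le]
        exact fun x hx => (t.2 x hx).2⟩
  have hf : f.Bijective := by
    constructor
    · intro t t' h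
      have h' := congrArg Subtype.val h
      exact Subtype.ext ((Multiset.cons_inj_right _).1 h')
    · rintro ⟨s, hs, h1, hm⟩
      have hmem : m + 2 ∈ s := by
        by_contra hne
        have : s.sup ≤ m + 1 := Multiset.sup_le.2 fun x hx => by
          have h2 : x ≤ s.sup := Multiset.le_sup hx
          have h3 : x ≠ m + 2 := fun h => hne (h ▸ hx)
          omega
        omega
      obtain ⟨t, rfl⟩ := Multiset.exists_cons_of_mem hmem
      refine ⟨⟨t, fun x hx => ?_⟩, rfl⟩
      have h2 : x ≤ ((m + 2) ::ₘ t).sup := Multiset.le_sup (Multiset.mem_cons_of_mem hx)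
      have h3 := hs x (Multiset.mem_cons_of_mem hx)
      have h4 : x ≠ 1 := by
        rintro rfl
        exact Multiset.count_eq_zero.1 h1 (Multiset.mem_cons_of_mem hx)
      omega
  rw [← wtSeries_boundedMultiset, ← wtSeries_add_const]
  refine (wtSeries_bijective (w' := fun s : NoOnesMultiset (m + 2) => s.1.sum) hf fun t => ?_).symm
  simp [f, add_comm]

theorem natCard_crank_of_pos (m : ℤ) (j N : ℕ) (hj : 0 < j) :
    (Nat.card {p : N.Partition // p.parts.count 1 = j ∧ crank p = m} : ℤ) =
      coeff N (X ^ (j + (m + j).toNat * (j + 1)) * ((1 - X) * invPoch j * invPochInt (m + j))) := by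
  unfold invPochInt
  split_ifs with h
  · rw [← wtSeries_onesMultiset _ _ hj, wtSeries, coeff_mk]
    congr 1
    refine Nat.card_congr ⟨fun p => ⟨⟨p.1.parts, fun _ hx => p.1.parts_pos hx, p.2.1, ?_⟩,
      p.1.parts_sum⟩, fun s => ⟨⟨s.1.1, fun hx => s.1.2.1 _ hx, s.2⟩, s.1.2.2.1, ?_⟩,
      fun _ => rfl, fun _ => rfl⟩
    · obtain ⟨p, hp, hc⟩ := p
      rw [crank, if_neg (by omega), hp] at hc
      simp only
      omega
    · obtain ⟨⟨s, h1, h2, h3⟩, h4⟩ := s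
      rw [crank]
      simp only
      rw [if_neg (by omega), h2, h3]
      omega
  · have : IsEmpty {p : N.Partition // p.parts.count 1 = j ∧ crank p = m} := ⟨by
      rintro ⟨p, hp, hc⟩
      rw [crank, if_neg (by omega), hp] at hc
      omega⟩
    simp

/-- The formula gives the true count except for `m = 0`, where it is `1 - X` instead of `1`, and `m
= 1`, where it is `X` instead of `0`. These are the exceptional values of `N'`. -/
theorem natCard_crank_zero (m : ℤ) (N : ℕ) :
    (Nat.card {p : N.Partition // p.parts.count 1 = 0 ∧ crank p = m} : ℤ) +
      (if N = 1 ∧ m = 1 then 1 else if N = 1 ∧ m = 0 then -1 else 0) =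
      coeff N (X ^ m.toNat * ((1 - X) * invPochInt m)) := by
  unfold invPochInt
  have hone : invPoch 1 * (1 - X) = invPoch 0 := by simpa using invPoch_succ 0
  have two_le : ∀ p : N.Partition, p.parts.count 1 = 0 → ∀ x ∈ p.parts, 2 ≤ x ∧ x ≤ p.parts.sup := by
    intro p hp x hx
    have h1 := p.parts_pos hx
    have h2 : x ≤ p.parts.sup := Multiset.le_sup hx
    have h3 : x ≠ 1 := by
      rintro rfl
      exact Multiset.count_eq_zero.1 hp hx
    omega
  rcases lt_or_ge m 0 with hm | hm
  · have : IsEmpty {p : N.Partition // p.parts.count 1 = 0 ∧ crank p = m} := ⟨by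
      rintro ⟨p, hp, hc⟩
      rw [crank, if_pos hp] at hc
      omega⟩
    rw [if_neg (by omega), if_neg (by omega), if_neg (by omega), Nat.card_of_isEmpty]
    simp
  obtain ⟨m, rfl⟩ := Int.eq_ofNat_of_zero_le hm
  rw [if_pos hm, Int.toNat_natCast]
  match m with
  | 0 =>
    have hempty : ∀ p : N.Partition, p.parts.count 1 = 0 ∧ crank p = ((0 : ℕ) : ℤ) →
        p.parts = 0 := by
      rintro p ⟨hp, hc⟩
      rw [crank, if_pos hp] at hc
      refine Multiset.eq_zero_of_forall_notMem fun x hx => ?_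
      have := two_le p hp x hx
      omega
    have hcard : Nat.card {p : N.Partition // p.parts.count 1 = 0 ∧ crank p = ((0 : ℕ) : ℤ)} =
        if N = 0 then 1 else 0 := by
      split_ifs with hN
      · subst hN
        refine Nat.card_eq_one_iff_unique.2 ⟨⟨fun p q => ?_⟩,
          ⟨⟨⟨0, by simp, by simp⟩, by simp, by simp [crank]⟩⟩⟩
        apply Subtype.ext
        apply Nat.Partition.ext
        rw [hempty p p.2, hempty q q.2]
      · have : IsEmpty {p : N.Partition // p.parts.count 1 = 0 ∧ crank p = ((0 : ℕ) : ℤ)} :=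
          ⟨fun p => hN (by rw [← p.1.parts_sum, hempty p p.2]; simp)⟩
        exact Nat.card_of_isEmpty
    rw [hcard]
    simp only [invPoch, pow_zero, one_mul, mul_one, map_sub, coeff_one, coeff_X]
    rcases N with _ | _ | N <;> simp
  | 1 =>
    have : IsEmpty {p : N.Partition // p.parts.count 1 = 0 ∧ crank p = ((1 : ℕ) : ℤ)} := ⟨by
      rintro ⟨p, hp, hc⟩
      rw [crank, if_pos hp] at hc
      have h0 : p.parts = 0 := Multiset.eq_zero_of_forall_notMem fun x hx => by
        have := two_le p hp x hx
        omega
      rw [h0] at hc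
      simp at hc⟩
    rw [mul_comm (1 - X), hone, invPoch, mul_one, pow_one, coeff_X, Nat.card_of_isEmpty]
    simp
  | m + 2 =>
    rw [if_neg (by omega), if_neg (by omega), add_zero, ← wtSeries_noOnesMultiset, wtSeries,
      coeff_mk]
    congr 1
    refine Nat.card_congr ⟨fun p => ⟨⟨p.1.parts, fun _ hx => p.1.parts_pos hx, p.2.1, ?_⟩,
      p.1.parts_sum⟩, fun s => ⟨⟨s.1.1, fun hx => s.1.2.1 _ hx, s.2⟩, s.1.2.2.1, ?_⟩,
      fun _ => rfl, fun _ => rfl⟩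
    · obtain ⟨p, hp, hc⟩ := p
      rw [crank, if_pos hp] at hc
      exact_mod_cast hc
    · obtain ⟨⟨s, h1, h2, h3⟩, h4⟩ := s
      rw [crank]
      simp only
      rw [if_pos h2, h3]

/-- The only partition of `1` has crank `-1`, so the prescribed value `N'(-1, 1) = 1` needs no
correction. -/
theorem crankCountNat_eq (m : ℤ) (N : ℕ) :
    crankCountNat m N = (Nat.card {p : N.Partition // crank p = m} : ℤ) +
      (if N = 1 ∧ m = 1 then 1 else if N = 1 ∧ m = 0 then -1 else 0) := by
  have hc : ((Finset.univ.filter fun p : N.Partition => crank p = m).card : ℤ) =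
      (Nat.card {p : N.Partition // crank p = m} : ℤ) := by
    rw [Nat.card_eq_fintype_card, Fintype.card_subtype]
  unfold crankCountNat
  rw [hc]
  by_cases hN : N = 1
  · subst hN
    have h1 : ∀ p : (1 : ℕ).Partition, crank p = -1 := fun p => by
      rw [Subsingleton.elim p (Nat.Partition.indiscrete 1)]
      decide
    simp only [h1]
    by_cases hm : m = -1
    · subst hm
      simp
    · have : IsEmpty {p : (1 : ℕ).Partition // -1 = m} := ⟨fun p => hm p.2.symm⟩
      by_cases hm1 : m = 1
      · simp [hm1]
      · by_cases hm0 : m = 0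
        · simp [hm0]
        · simp [hm, hm0, hm1]
  · simp [hN]

/-- The generating function of the crank. -/
theorem crankCountNat_eq_coeff (m : ℤ) (K N : ℕ) (h : N < K) :
    crankCountNat m N = coeff N ((1 - X) * ∑ j ∈ Finset.range K,
      X ^ (j + (m + j).toNat * (j + 1)) * (invPoch j * invPochInt (m + j))) := by
  rw [crankCountNat_eq, card_eq_sum_card_fiber inferInstance (fun p => p.parts.count 1) K,
    Finset.mul_sum, map_sum]
  · obtain ⟨K, rfl⟩ := Nat.exists_eq_succ_of_ne_zero (Nat.ne_of_gt (Nat.zero_lt_of_lt h))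
    -- The term `j = 0` is split off, since it alone absorbs the correction at `N = 1`.
    have e : ∀ a b c : ℤ⟦X⟧, c * ((1 - X) * a * b) = (1 - X) * (c * (a * b)) := by
      intros; ring
    rw [Finset.sum_range_succ', Finset.sum_range_succ', Nat.cast_add, Nat.cast_sum, add_assoc,
      natCard_crank_zero]
    congr 1
    · refine Finset.sum_congr rfl fun j _ => ?_
      rw [natCard_crank_of_pos _ _ _ (Nat.succ_pos j), e]
    · simp only [invPoch, Nat.cast_zero, add_zero, zero_add, mul_one, one_mul]
      rw [mul_left_comm]
  · intro p _
    have h1 := Multiset.count_le_card 1 p.parts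
    have h2 := card_le_sum_of_pos fun x hx => p.parts_pos (i := x) hx
    rw [p.parts_sum] at h2
    omega

end Counting

/-! ### Matching the two series, and telescoping. -/

section Comparison

open PowerSeries Finset

/-! ### Comparison of the two generating functions -/

/-- At `z = 0` the factor `1 - X ^ 0` vanishes, in accordance with `1/(q)_{-1} = 0`. -/
theorem invPochInt_mul (z : ℤ) : invPochInt z * (1 - X ^ z.toNat) = invPochInt (z - 1) := by
  unfold invPochInt
  rcases lt_trichotomy z 0 with hz | rfl | hz
  · rw [if_neg (by omega), if_neg (by omega), zero_mul]
  · simp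
  · obtain ⟨k, rfl⟩ : ∃ k : ℕ, z = k + 1 := ⟨(z - 1).toNat, by omega⟩
    rw [if_pos (by omega), if_pos (by omega), show ((k : ℤ) + 1).toNat = k + 1 by omega,
      invPoch_succ, show ((k : ℤ) + 1 - 1).toNat = k by omega]

/-- A sum over pairs `(i, j)` with `i - j = m` depends, up to the order `K`, only on `|m|`. -/
theorem X_pow_dvd_sum_sub_sum_natAbs (e : ℕ → ℕ → ℕ) (he : ∀ i j, e i j = e j i)
    (hle : ∀ i j, i + j ≤ e i j) (m : ℤ) (K : ℕ) :
    X ^ K ∣ ∑ j ∈ range K, X ^ e j (m + j).toNat * (invPoch j * invPochInt (m + j)) -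
      ∑ j ∈ range K, X ^ e j (j + m.natAbs) * (invPoch j * invPoch (j + m.natAbs)) := by
  rcases le_or_gt 0 m with hm | hm
  · rw [← sum_sub_distrib]
    refine dvd_sum fun j _ => ?_
    rw [invPochInt, if_pos (by omega), show (m + j).toNat = j + m.natAbs by omega, sub_self]
    exact dvd_zero _
  · set p := m.natAbs with hp
    -- For `m = -p` the terms with `j < p` vanish and `j = i + p` exchanges the two indices. The
    -- range shrinks to `K - p`, but the missing terms have order at least `i + (i + p) ≥ K`.
    have h1 : ∑ j ∈ range K, X ^ e j (m + j).toNat * (invPoch j * invPochInt (m + j)) =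
        ∑ i ∈ range (K - p), X ^ e i (i + p) * (invPoch i * invPoch (i + p)) := by
      have hs : (range (K - p)).map (addRightEmbedding p) ⊆ range K := by
        intro j hj
        simp only [mem_map, mem_range, addRightEmbedding_apply] at hj ⊢
        obtain ⟨i, hi, rfl⟩ := hj
        omega
      rw [← sum_subset hs, sum_map]
      · refine sum_congr rfl fun i _ => ?_
        rw [addRightEmbedding_apply, invPochInt, if_pos (by omega),
          show (m + ((i + p : ℕ) : ℤ)).toNat = i by omega, he, mul_comm (invPoch i)]
      · intro j hj hj'
        have : ¬ 0 ≤ m + j := fun h => hj' (mem_map.2 ⟨j - p, by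
          simp only [mem_range] at hj ⊢; omega, by rw [addRightEmbedding_apply]; omega⟩)
        rw [invPochInt, if_neg this, mul_zero, mul_zero]
    rw [h1, ← sum_sdiff (range_subset_range.2 (Nat.sub_le K p)), sub_add_cancel_right]
    refine (dvd_sum fun j hj => ?_).neg_right
    rw [mem_sdiff, mem_range, mem_range] at hj
    refine (pow_dvd_pow X ?_).mul_right _
    have := hle j (j + p)
    omega

theorem coeff_eq_of_X_pow_dvd_sub {f g : ℤ⟦X⟧} {K N : ℕ} (h : X ^ K ∣ f - g) (hN : N < K) :
    coeff N f = coeff N g := by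
  rw [← sub_eq_zero, ← map_sub]
  exact X_pow_dvd_iff.1 h N hN

theorem X_pow_dvd_of_coeff_eq {f g : ℤ⟦X⟧} {K : ℕ} (h : ∀ N < K, coeff N f = coeff N g) :
    X ^ K ∣ f - g :=
  X_pow_dvd_iff.2 fun N hN => by rw [map_sub, h N hN, sub_self]

theorem crankCountNat_eq_finrank_sub (m : ℤ) (N : ℕ) :
    crankCountNat m N = (Module.finrank ℂ (hwvDegreeCharge ((4 * N + m) / 2) m) : ℤ) -
      Module.finrank ℂ (hwvDegreeCharge ((4 * N + (m - 1 : ℤ)) / 2) (m - 1)) := by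
  set K := N + 1 with hK
  have hNK : N < K := Nat.lt_succ_self N
  -- With `K + 1` conditions, splitting `1 - X` off the product leaves exactly the `K` factors of
  -- `X_pow_dvd_heine`.
  rw [hwvDegreeCharge_eq_partialHwv m N (K + 1) (by omega),
    hwvDegreeCharge_eq_partialHwv (m - 1) N (K + 1) (by omega), ← coeff_prod_mul_fockSeries,
    ← coeff_prod_mul_fockSeries, ← map_sub, ← mul_sub, prod_range_succ', zero_add, pow_one,
    mul_comm _ (1 - X), mul_assoc, crankCountNat_eq_coeff m K N hNK]
  refine coeff_eq_of_X_pow_dvd_sub ?_ hNK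
  rw [← mul_sub]
  refine Dvd.dvd.mul_left ?_ _
  have hF : ∀ m, X ^ K ∣ fockSeries m -
      ∑ j ∈ range K, X ^ j * (invPoch j * invPochInt (m + j)) := fun m =>
    X_pow_dvd_of_coeff_eq fun N hN => coeff_fockSeries m K N hN
  have hD : ∑ j ∈ range K, X ^ j * (invPoch j * invPochInt (m + j)) -
      ∑ j ∈ range K, X ^ j * (invPoch j * invPochInt (m - 1 + j)) =
      ∑ j ∈ range K, X ^ (j + (m + j).toNat) * (invPoch j * invPochInt (m + j)) := by
    rw [← sum_sub_distrib]
    refine sum_congr rfl fun j _ => ?_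
    rw [show m - 1 + j = m + j - 1 by ring, ← invPochInt_mul]
    ring
  -- Both exponents, `i + j` and `i + j + i j`, are symmetric, so both sums reduce to `|m|`, where
  -- Heine's identity applies.
  have h1 := X_pow_dvd_sum_sub_sum_natAbs (fun i j => i + j) (fun i j => add_comm _ _)
    (fun i j => le_rfl) m K
  have h2 := X_pow_dvd_sum_sub_sum_natAbs (fun i j => i + j * (i + 1)) (fun i j => by ring)
    (fun i j => by nlinarith [Nat.zero_le (j * i)]) m K
  have h3 := X_pow_dvd_heine K m.natAbs (Nat.succ_pos N)
  have e1 : ∑ j ∈ range K, X ^ (j + (j + m.natAbs)) * (invPoch j * invPoch (j + m.natAbs)) =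
      X ^ m.natAbs * ∑ j ∈ range K, X ^ (2 * j) * invPoch j * invPoch (j + m.natAbs) := by
    rw [mul_sum]
    exact sum_congr rfl fun j _ => by ring
  have e2 : ∑ j ∈ range K,
      X ^ (j + (j + m.natAbs) * (j + 1)) * (invPoch j * invPoch (j + m.natAbs)) =
      X ^ m.natAbs * ∑ j ∈ range K,
        X ^ (2 * j + j * (j + m.natAbs)) * invPoch j * invPoch (j + m.natAbs) := by
    rw [mul_sum]
    exact sum_congr rfl fun j _ => by ring
  simp only [e1] at h1
  simp only [e2] at h2
  have h4 := dvd_sub (hF m) (hF (m - 1))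
  have h5 := dvd_sub (dvd_sub h2 (h3.mul_left (X ^ m.natAbs)))
    ((dvd_add h4 h1).mul_left (∏ r ∈ range K, (1 - X ^ (r + 2))))
  convert h5 using 1
  rw [← hD]
  ring

theorem finrank_hwvDegreeCharge_eq_zero (m : ℤ) (N : ℕ) (h : m + N < 0) :
    Module.finrank ℂ (hwvDegreeCharge ((4 * N + m) / 2) m) = 0 := by
  rw [hwvDegreeCharge_eq_partialHwv m N N le_rfl, partialHwv, gradedPiece_eq_bot (Or.inr h),
    bot_inf_eq, finrank_bot]

theorem crankCountNat_support_finite (m : ℤ) (N : ℕ) :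
    (Function.support fun l : ℕ => crankCountNat (m - l) N).Finite := by
  refine (Set.finite_Iio (m + N + 1).toNat).subset fun l hl => ?_
  by_contra hne
  rw [Set.mem_Iio] at hne
  apply hl
  simp only
  rw [crankCountNat_eq_finrank_sub, finrank_hwvDegreeCharge_eq_zero _ _ (by omega),
    finrank_hwvDegreeCharge_eq_zero _ _ (by omega), sub_self]

/-- The sum of differences telescopes and stops because grade `N` contains no nonzero vector of
charge below `-N`. -/
theorem finrank_hwvDegreeCharge (m : ℤ) (N : ℕ) :
    (Module.finrank ℂ (hwvDegreeCharge ((4 * N + m) / 2) m) : ℤ) =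
      ∑ᶠ l : ℕ, crankCountNat (m - l) N := by
  obtain ⟨d, hd⟩ : ∃ d : ℤ → ℤ, ∀ m : ℤ,
      (Module.finrank ℂ (hwvDegreeCharge ((4 * N + m) / 2) m) : ℤ) = d m := ⟨_, fun _ => rfl⟩
  have hstep : ∀ m, crankCountNat m N = d m - d (m - 1) := fun m => by
    rw [crankCountNat_eq_finrank_sub, hd, hd]
  have hzero : ∀ m : ℤ, m + N < 0 → d m = 0 := fun m hm => by
    rw [← hd, finrank_hwvDegreeCharge_eq_zero m N hm, Nat.cast_zero]
  have hsub : (Function.support fun l : ℕ => crankCountNat (m - l) N) ⊆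
      range (m + N + 1).toNat := by
    intro l hl
    by_contra hne
    rw [coe_range, Set.mem_Iio] at hne
    apply hl
    simp only
    rw [hstep, hzero _ (by omega), hzero _ (by omega), sub_self]
  have hterm : ∀ l ∈ range (m + N + 1).toNat,
      crankCountNat (m - l) N = d (m - l) - d (m - (l + 1 : ℕ)) := by
    intro l _
    rw [hstep]
    congr 2
    push_cast
    ring
  rw [hd, finsum_eq_sum_of_support_subset _ hsub, sum_congr rfl hterm,
    sum_range_sub' (fun l : ℕ => d (m - l)), hzero (m - ((m + N + 1).toNat : ℤ)) (by omega)]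
  simp

theorem crankCount_natCast (m : ℤ) (N : ℕ) : crankCount m (N : ℚ) = crankCountNat m N := by
  simp [crankCount]

theorem crankCount_eq_zero (m : ℤ) (x : ℚ) (h : ∀ N : ℕ, x ≠ N) : crankCount m x = 0 := by
  rw [crankCount, if_neg (h _)]

end Comparison

end CKP

theorem mainTheorem11 (n : ℚ) (m : ℤ) :
    (FiniteDimensional ℂ (CKP.hwvDegreeCharge n m) ∧
      (Function.support fun l : ℕ => CKP.crankCount (m - l) ((2 * n - m) / 4)).Finite ∧
      (Module.finrank ℂ (CKP.hwvDegreeCharge n m) : ℤ) =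
        ∑ᶠ l : ℕ, CKP.crankCount (m - l) ((2 * n - m) / 4)) ∧
    (∀ v ∈ CKP.hwvDegreeCharge n m, v ≠ 0 → ∃ k : ℤ, 2 * n - m = 4 * k) := by
  -- The grade of a monomial is a natural number, so otherwise both the space and every summand
  -- vanish.
  by_cases h : ∃ N : ℕ, 2 * n - m = 4 * N
  · obtain ⟨N, hN⟩ := h
    have hn : n = (4 * N + m) / 2 := by linarith
    have hx : (2 * n - m) / 4 = N := by rw [hN]; ring
    refine ⟨⟨?_, ?_, ?_⟩, fun _ _ _ => ⟨N, by exact_mod_cast hN⟩⟩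
    · rw [hn, CKP.hwvDegreeCharge_eq_partialHwv m N N le_rfl]
      infer_instance
    · simp only [hx, CKP.crankCount_natCast]
      exact CKP.crankCountNat_support_finite m N
    · simp only [hx, CKP.crankCount_natCast]
      rw [hn]
      exact CKP.finrank_hwvDegreeCharge m N
  · push Not at h
    have hbot := CKP.hwvDegreeCharge_eq_bot n m h
    have hx : ∀ N : ℕ, (2 * n - m) / 4 ≠ N := fun N hN => h N (by linarith)
    rw [hbot]
    simp only [CKP.crankCount_eq_zero _ _ hx]
    refine ⟨⟨inferInstance, ?_, ?_⟩, fun v hv hv0 => absurd ((Submodule.mem_bot ℂ).1 hv) hv0⟩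
    · simp
    · simp
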